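/- **Setting.** Let $G\subset\mathbb C\cup\{\infty\}$ be an unbounded multiply connected region of connectivity $m$ with $\infty\in G$ and $0\in G$, whose boundary $\Gamma=\Gamma_1\cup\dots\cup\Gamma_m$ consists of simple, pairwise disjoint, clockwise oriented closed curves, such that the complement of $G\cup\Gamma$ consists of $m$ bounded simply connected regions $G_1,\dots,G_m$ with $\partial G_k=\Gamma_k$. Let $\Gamma_k$ be parametrized by a $2\pi$-periodic, twice continuously differentiable function $\eta_k$ with $\dot\eta_k\neq0$. Let $J$ be the disjoint union of the intervals $J_k=[0,2\pi]$, $k=1,\dots,m$, and let $\eta$ be the function on $J$ that equals $\eta_k$ on $J_k$. Let $A$ be a continuously differentiable, nowhere vanishing complex function on $\Gamma$, given in parametric form $t\mapsto A(t)$, $t\in J$ (so $A$ is $2\pi$-periodic and $C^1$ on each $J_k$). Let $H$ be the space of real functions on $J$ that are Hölder continuous and $2\pi$-periodic on each $J_k$. Define real kernels $M,N$ by $$M(s,t)+\mathrm i N(s,t)=\frac1\pi\,\frac{A(s)}{A(t)}\,\frac{\dot\eta(t)}{\eta(t)-\eta(s)},\qquad \eta(s)\ne\eta(t),\qquad N(t,t)=\frac1\pi\operatorname{Im}\Big(\frac12\frac{\ddot\eta(t)}{\dot\eta(t)}-\frac{\dot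 A(t)}{A(t)}\Big),$$ and operators $$\mathbf N\phi(s)=\int_J N(s,t)\phi(t)\,dt,\qquad \mathbf M\phi(s)=\mathrm{p.v.}\!\int_J M(s,t)\phi(t)\,dt,\qquad s\in J,$$ where the second integral is a Cauchy principal value. **Theorem.** Let $\gamma\in H$, and let $f$ be a solution of the Riemann–Hilbert problem $\operatorname{Re}[Af^+]=\gamma$; that is, $f$ is analytic in $G$ with $f(\infty)=0$, continuous on $G\cup\Gamma$, and its boundary values $f^+$ on $\Gamma$ satisfy $\operatorname{Re}[Af^+]=\gamma$. Write $Af^+=\gamma+\mathrm i\mu$ with $\mu$ real. Then the kernel $N$ is continuous, the principal value $\mathbf M\gamma(s)$ exists for every $s\in J$, and $\mu$ satisfies the second-kind Fredholm integral equation $$\mu-\mathbf N\mu=-\mathbf M\gamma\qquad\text{on }J.$$ -/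

import Mathlib

open Set Filter Topology Complex

noncomputable section

/-- The winding number `(1 / 2πi) ∫ dη / (η - z)` about `z` of a closed curve `η` parametrized
over `[0, 2π]`. -/
def windingNumber (η : ℝ → ℂ) (z : ℂ) : ℂ :=
  (2 * (Real.pi : ℂ) * I)⁻¹ * ∫ t in (0 : ℝ)..2 * Real.pi, deriv η t / (η t - z)

/-- An unbounded multiply connected region `G ⊆ ℂ ∪ {∞}` of connectivity `m` with `∞ ∈ G` and
`0 ∈ G` (here `G` stands for its finite part), bounded by `m` simple, pairwise disjoint, clockwise
oriented closed curves `Γ k`, each parametrized by a `2π`-periodic, twice continuously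
differentiable function `η k` with nonvanishing derivative.  The complement of `G ∪ Γ` consists of
`m` bounded simply connected regions `Gc k`, the insides of the curves `Γ k`. -/
structure UnboundedRegion (m : ℕ) where
  /-- the finite part of the region -/
  G : Set ℂ
  /-- the parametrizations of the boundary curves -/
  η : Fin m → ℝ → ℂ
  /-- the bounded components of the complement -/
  Gc : Fin m → Set ℂ
  isOpen_G : IsOpen G
  isConnected_G : IsConnected G
  infty_mem : Bornology.IsBounded Gᶜ
  zero_mem : (0 : ℂ) ∈ G
  periodic : ∀ k, Function.Periodic (η k) (2 * Real.pi)
  contDiff : ∀ k, ContDiff ℝ 2 (η k)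
  deriv_ne_zero : ∀ k t, deriv (η k) t ≠ 0
  simple : ∀ k, InjOn (η k) (Ico 0 (2 * Real.pi))
  disjoint_curves : Pairwise fun j k => Disjoint (range (η j)) (range (η k))
  frontier_G : frontier G = ⋃ k, range (η k)
  isOpen_Gc : ∀ k, IsOpen (Gc k)
  isBounded_Gc : ∀ k, Bornology.IsBounded (Gc k)
  simplyConnected_Gc : ∀ k, IsSimplyConnected (Gc k)
  disjoint_Gc : Pairwise fun j k => Disjoint (Gc j) (Gc k)
  frontier_Gc : ∀ k, frontier (Gc k) = range (η k)
  compl_closure_G : (closure G)ᶜ = ⋃ k, Gc k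
  clockwise : ∀ k, ∀ z ∈ Gc k, windingNumber (η k) z = -1

/-- The space `H` of real functions `φ = (φ 1, …, φ m)` on the parameter domain `J` (the disjoint
union of `m` copies of `[0, 2π]`) all of whose components are `2π`-periodic and Hölder
continuous. -/
def holderSpace (m : ℕ) : Set (Fin m → ℝ → ℝ) :=
  {φ | ∀ k, Function.Periodic (φ k) (2 * Real.pi) ∧
    ∃ C α : NNReal, 0 < α ∧ α ≤ 1 ∧ HolderWith C α (φ k)}

/-- An admissible coefficient: `A` is a continuously differentiable, nowhere vanishing complex
function on the boundary, given in parametric form. -/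
structure IsCoefficient {m : ℕ} (A : Fin m → ℝ → ℂ) : Prop where
  periodic : ∀ k, Function.Periodic (A k) (2 * Real.pi)
  contDiff : ∀ k, ContDiff ℝ 1 (A k)
  ne_zero : ∀ k t, A k t ≠ 0

namespace UnboundedRegion

variable {m : ℕ} (D : UnboundedRegion m) (A : Fin m → ℝ → ℂ)

/-- `f` solves the interior Riemann-Hilbert problem `Re [A f⁺] = γ`: it is analytic in `G`,
vanishes at `∞` (so that it is analytic there too, the singularity being removable), is continuous
on `G ∪ Γ = closure G`, and its boundary values `f⁺`, that is, the values of `f` on `Γ`, satisfy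
the boundary condition. -/
structure IsRHSolution (γ : Fin m → ℝ → ℝ) (f : ℂ → ℂ) : Prop where
  analytic : DifferentiableOn ℂ f D.G
  infty_zero : Tendsto f (Bornology.cobounded ℂ) (𝓝 0)
  continuousOn : ContinuousOn f (closure D.G)
  boundary : ∀ k s, (A k s * f (D.η k s)).re = γ k s

/-- The complex kernel `(1/π) (A(s) / A(t)) η'(t) / (η(t) - η(s))`, with `s` in the `k`-th and `t`
in the `j`-th parameter interval. -/
def kernel (k : Fin m) (s : ℝ) (j : Fin m) (t : ℝ) : ℂ :=
  (Real.pi : ℂ)⁻¹ * (A k s / A j t) * (deriv (D.η j) t / (D.η j t - D.η k s))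

/-- The singular kernel `M(s, t)`, the real part of `kernel`. -/
def kernelM (k : Fin m) (s : ℝ) (j : Fin m) (t : ℝ) : ℝ :=
  (D.kernel A k s j t).re

open Classical in
/-- The generalized Neumann kernel `N(s, t)`: the imaginary part of `kernel`, with the diagonal
value `(1/π) Im (η''(t) / (2 η'(t)) - A'(t) / A(t))`.  The points `η j t` and `η k s` coincide
just when `j = k` and `t ≡ s` modulo `2π`. -/
def kernelN (k : Fin m) (s : ℝ) (j : Fin m) (t : ℝ) : ℝ :=
  if D.η j t = D.η k s then
    Real.pi⁻¹ * (1 / 2 * (deriv (deriv (D.η j)) t / deriv (D.η j) t) - deriv (A j) t / A j t).im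
  else (D.kernel A k s j t).im

/-- The integral operator `(𝐍 φ)(s) = ∫_J N(s, t) φ(t) dt`. -/
def opN (φ : Fin m → ℝ → ℝ) (k : Fin m) (s : ℝ) : ℝ :=
  ∑ j, ∫ t in (0 : ℝ)..2 * Real.pi, D.kernelN A k s j t * φ j t

/-- The integral `∫ M(s, t) φ(t) dt` over `J` without the parameters at distance less than `ε`
(modulo `2π`) from the singularity `s`.  On the `k`-th parameter interval, which holds `s`,
`2π`-periodicity is used to write it as an integral over `[s + ε, s + 2π - ε]`. -/
def truncM (φ : Fin m → ℝ → ℝ) (k : Fin m) (s ε : ℝ) : ℝ :=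
  (∫ t in (s + ε)..(s + 2 * Real.pi - ε), D.kernelM A k s k t * φ k t) +
    ∑ j ∈ Finset.univ.erase k, ∫ t in (0 : ℝ)..2 * Real.pi, D.kernelM A k s j t * φ j t

/-- The singular operator `(𝐌 φ)(s) = ∫_J M(s, t) φ(t) dt`, a Cauchy principal value. -/
def opM (φ : Fin m → ℝ → ℝ) (k : Fin m) (s : ℝ) : ℝ :=
  limUnder (𝓝[>] (0 : ℝ)) (D.truncM A φ k s)

end UnboundedRegion

end

noncomputable section

/-! ### Integrals depending on a parameter -/

/-! Multiplying the complex kernel by `γ + iμ = A f⁺` cancels `A(t)` and leaves `A(s)/π` times the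
Cauchy integrand of `f` at `η(s)`. The real part of this product is `M γ - N μ`, so the equation
amounts to the boundary formula p.v. `∫ f dη / (η - η(s)) = π i f(η(s))`: multiplied by `A(s)/π` it
becomes `i A f⁺`, whose real part is `-μ`.

The boundary formula (`UnboundedRegion.tendsto_truncCauchyInt`) has to hold for boundary values that
are merely continuous. The base point is approached along the normal from inside the hole. There
Cauchy's theorem gives the integral over all curves the value zero. For a density vanishing at the
base point, the Cauchy integral at distance `x` and the integral truncated at `x` differ by `o(1)`.
The remaining constant density is treated with explicit logarithms
(`IsRegularLoop.tendsto_truncCauchyInt_one`), and this also decides on which side of a curve the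
region lies.

Cauchy's theorem up to the boundary comes from pushing the curves into `G` along their normals,
applying Dixon's argument there and letting the shift tend to zero. The kernel `N` is continuous
because the only singular term of the complex kernel, `1 / (π (t - s))`, is real. -/

theorem continuousOn_parametric_intervalIntegral {X : Type*} [TopologicalSpace X]
    [FirstCountableTopology X] {F : X → ℝ → ℂ} {S : Set X} {a b : ℝ}
    (hF : ContinuousOn (Function.uncurry F) (S ×ˢ uIcc a b)) :
    ContinuousOn (fun x => ∫ t in a..b, F x t) S := by
  rw [continuousOn_iff_continuous_domRestrict]
  have h1 : Continuous fun x : S => ∫ t in a..b, F x (projIcc (min a b) (max a b) min_le_max t) := by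
    refine intervalIntegral.continuous_parametric_intervalIntegral_of_continuous'
      (f := fun (x : S) t => F x (projIcc (min a b) (max a b) min_le_max t)) ?_ a b
    exact hF.comp_continuous
      (f := fun p : S × ℝ => ((p.1 : X), (projIcc (min a b) (max a b) min_le_max p.2 : ℝ)))
      (by fun_prop) fun p => ⟨p.1.2, (projIcc (min a b) (max a b) min_le_max p.2).2⟩
  refine h1.congr fun x => intervalIntegral.integral_congr fun t ht => ?_
  rw [projIcc_of_mem _ ht]

/-- Cauchy's estimate on circles of radius `r / 3` dominates the derivative of the integrand, so
joint continuity of `F` suffices and nothing need be assumed about that derivative. -/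
theorem hasDerivAt_parametric_intervalIntegral {F : ℂ → ℝ → ℂ} {U : Set ℂ} (hU : IsOpen U)
    (hF : ContinuousOn (Function.uncurry F) (U ×ˢ univ))
    (hd : ∀ t, DifferentiableOn ℂ (fun z => F z t) U) (a b : ℝ) {z : ℂ} (hz : z ∈ U) :
    HasDerivAt (fun z => ∫ t in a..b, F z t) (∫ t in a..b, deriv (fun w => F w t) z) z := by
  obtain ⟨r, hr, hball⟩ := Metric.isOpen_iff.1 hU z hz
  have hr3 : 0 < r / 3 := by positivity
  have hsub : ∀ x ∈ Metric.ball z (r / 3), Metric.closedBall x (r / 3) ⊆ U := by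
    intro x hx y hy
    apply hball
    rw [Metric.mem_ball] at hx ⊢
    rw [Metric.mem_closedBall] at hy
    linarith [dist_triangle y x z]
  have hcont : ∀ x ∈ U, Continuous (F x) := fun x hx =>
    hF.comp_continuous (f := fun t : ℝ => (x, t)) (by fun_prop) fun t => ⟨hx, mem_univ _⟩
  have hK : IsCompact (Metric.closedBall z (2 * r / 3) ×ˢ uIcc a b) :=
    (isCompact_closedBall _ _).prod isCompact_uIcc
  have hKU : Metric.closedBall z (2 * r / 3) ⊆ U :=
    (Metric.closedBall_subset_ball (by linarith)).trans hball
  obtain ⟨M, hM⟩ := hK.exists_bound_of_continuousOn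
    (hF.mono (prod_mono hKU (subset_univ _)))
  refine (intervalIntegral.hasDerivAt_integral_of_dominated_loc_of_deriv_le
    (F := F) (F' := fun x t => deriv (fun w => F w t) x) (bound := fun _ => M / (r / 3))
    (Metric.ball_mem_nhds z hr3) ?_ ((hcont z hz).intervalIntegrable _ _) ?_ ?_ ?_ ?_).2
  · filter_upwards [hU.mem_nhds hz] with x hx
    exact (hcont x hx).aestronglyMeasurable
  -- Measurability in `t` of the derivative at `z`: it is the pointwise limit of difference
  -- quotients along a sequence tending to `z`.
  · have hseq : Tendsto (fun n : ℕ => (z + ((r / 3 / (n + 1) : ℝ) : ℂ))) atTop (𝓝[≠] z) := by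
      refine tendsto_nhdsWithin_iff.2 ⟨?_, Eventually.of_forall fun n => ?_⟩
      · have h1 : Tendsto (fun n : ℕ => (r / 3 / ((n : ℝ) + 1) : ℝ)) atTop (𝓝 0) := by
          have := (tendsto_one_div_add_atTop_nhds_zero_nat (𝕜 := ℝ)).const_mul (r / 3)
          simpa [div_eq_mul_inv] using this
        have h2 := ((continuous_ofReal.tendsto 0).comp h1).const_add z
        simpa using h2
      · have : (r / 3 / ((n : ℝ) + 1)) ≠ 0 := by positivity
        simp only [mem_compl_iff, mem_singleton_iff, add_eq_left, ofReal_eq_zero]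
        exact this
    have hmem : ∀ n : ℕ, (z + ((r / 3 / (n + 1) : ℝ) : ℂ)) ∈ U := by
      intro n
      apply hball
      have h0 : 0 < r / 3 / ((n : ℝ) + 1) := by positivity
      rw [Metric.mem_ball, dist_eq_norm, add_sub_cancel_left, norm_real, Real.norm_of_nonneg h0.le]
      calc r / 3 / ((n : ℝ) + 1) ≤ r / 3 := div_le_self hr3.le (by
            have : (0 : ℝ) ≤ n := by positivity
            linarith)
        _ < r := by linarith
    refine aestronglyMeasurable_of_tendsto_ae (u := atTop)
      (f := fun (n : ℕ) t => slope (fun w => F w t) z (z + ((r / 3 / (n + 1) : ℝ) : ℂ)))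
      (fun n => ?_) (Eventually.of_forall fun t => ?_)
    · simp only [slope, vsub_eq_sub, smul_eq_mul]
      refine Continuous.aestronglyMeasurable ?_
      exact continuous_const.mul ((hcont _ (hmem n)).sub (hcont z hz))
    · exact (hasDerivAt_iff_tendsto_slope.1
        ((hd t).differentiableAt (hU.mem_nhds hz)).hasDerivAt).comp hseq
  · refine Eventually.of_forall fun t ht x hx => ?_
    refine norm_deriv_le_of_forall_mem_sphere_norm_le hr3
      ((hd t).diffContOnCl_ball (hsub x hx)) fun w hw => ?_
    refine hM (w, t) ⟨?_, uIoc_subset_uIcc ht⟩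
    rw [Metric.mem_ball] at hx
    rw [Metric.mem_sphere] at hw
    rw [Metric.mem_closedBall]
    linarith [dist_triangle w x z]
  · exact intervalIntegrable_const
  · refine Eventually.of_forall fun t ht x hx => ?_
    exact ((hd t).differentiableAt (hU.mem_nhds
      (hsub x hx (Metric.mem_closedBall_self hr3.le)))).hasDerivAt

/-! ### Cauchy integrals along closed curves -/

/-- The Cauchy integral `∫ g(t) η'(t) / (η(t) - z) dt` over a closed curve parametrized over
`[0, 2π]`. -/
def cauchyInt (η g : ℝ → ℂ) (z : ℂ) : ℂ :=
  ∫ t in (0 : ℝ)..2 * Real.pi, g t * (deriv η t / (η t - z))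

/-- A continuously differentiable closed curve, parametrized with period `2π`. -/
structure IsLoop (η : ℝ → ℂ) : Prop where
  periodic : Function.Periodic η (2 * Real.pi)
  contDiff : ContDiff ℝ 1 η

theorem windingNumber_eq_cauchyInt (η : ℝ → ℂ) (z : ℂ) :
    windingNumber η z = (2 * (Real.pi : ℂ) * I)⁻¹ * cauchyInt η (fun _ => 1) z := by
  simp [windingNumber, cauchyInt]

theorem cauchyInt_one (η : ℝ → ℂ) (z : ℂ) :
    cauchyInt η (fun _ => 1) z = 2 * (Real.pi : ℂ) * I * windingNumber η z := by
  rw [windingNumber_eq_cauchyInt, mul_inv_cancel_left₀ two_pi_I_ne_zero]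

theorem Function.Periodic.deriv_periodic {E : Type*} [NormedAddCommGroup E] [NormedSpace ℝ E]
    {f : ℝ → E} {c : ℝ} (hf : Function.Periodic f c) : Function.Periodic (deriv f) c := by
  intro x
  rw [← deriv_comp_add_const]
  congr 1
  exact funext hf

theorem Function.Periodic.isCompact_range_of_continuous {E : Type*} [TopologicalSpace E]
    {f : ℝ → E} (hf : Function.Periodic f (2 * Real.pi)) (hc : Continuous f) :
    IsCompact (range f) := by
  rw [← hf.image_Icc Real.two_pi_pos 0]
  exact isCompact_Icc.image hc

theorem Function.Periodic.exists_norm_le {E : Type*} [NormedAddCommGroup E]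
    {f : ℝ → E} (hf : Function.Periodic f (2 * Real.pi)) (hc : Continuous f) :
    ∃ M, 0 < M ∧ ∀ t, ‖f t‖ ≤ M := by
  obtain ⟨M, hM⟩ := (hf.isCompact_range_of_continuous hc).isBounded.exists_norm_le
  exact ⟨max M 1, by positivity, fun t => (hM _ (mem_range_self t)).trans (le_max_left _ _)⟩

theorem Function.Periodic.exists_pos_le {f : ℝ → ℝ} (hf : Function.Periodic f (2 * Real.pi))
    (hc : Continuous f) (hpos : ∀ t, 0 < f t) : ∃ c, 0 < c ∧ ∀ t, c ≤ f t := by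
  obtain ⟨x, ⟨t, rfl⟩, h⟩ := (hf.isCompact_range_of_continuous hc).exists_isLeast (range_nonempty f)
  exact ⟨f t, hpos t, fun s => h (mem_range_self s)⟩

namespace IsLoop

variable {η : ℝ → ℂ}

theorem continuous (hη : IsLoop η) : Continuous η := hη.contDiff.continuous

theorem continuous_deriv (hη : IsLoop η) : Continuous (deriv η) :=
  hη.contDiff.continuous_deriv le_rfl

theorem hasDerivAt (hη : IsLoop η) (t : ℝ) : HasDerivAt η (deriv η t) t :=
  (hη.contDiff.differentiable one_ne_zero t).hasDerivAt

theorem isCompact_range (hη : IsLoop η) : IsCompact (range η) :=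
  hη.periodic.isCompact_range_of_continuous hη.continuous

theorem isOpen_compl_range (hη : IsLoop η) : IsOpen (range η)ᶜ := hη.isCompact_range.isClosed.isOpen_compl

theorem sub_ne_zero_of_notMem (_ : IsLoop η) {z : ℂ} (hz : z ∉ range η) (t : ℝ) : η t - z ≠ 0 :=
  sub_ne_zero.2 fun h => hz ⟨t, h⟩

theorem continuousOn_cauchyKernel (hη : IsLoop η) {g : ℝ → ℂ} (hg : Continuous g) :
    ContinuousOn (Function.uncurry fun z t => g t * (deriv η t / (η t - z)))
      ((range η)ᶜ ×ˢ univ) := by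
  refine ContinuousOn.mul (hg.comp continuous_snd).continuousOn (ContinuousOn.div ?_ ?_ ?_)
  · exact (hη.continuous_deriv.comp continuous_snd).continuousOn
  · exact ((hη.continuous.comp continuous_snd).sub continuous_fst).continuousOn
  · rintro ⟨z, t⟩ ⟨hz, -⟩
    exact hη.sub_ne_zero_of_notMem hz t

theorem differentiableOn_cauchyKernel (hη : IsLoop η) (g : ℝ → ℂ) (t : ℝ) :
    DifferentiableOn ℂ (fun z => g t * (deriv η t / (η t - z))) (range η)ᶜ := by
  intro z hz
  have := hη.sub_ne_zero_of_notMem hz t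
  refine DifferentiableAt.differentiableWithinAt ?_
  fun_prop (disch := assumption)

theorem differentiableOn_cauchyInt (hη : IsLoop η) {g : ℝ → ℂ} (hg : Continuous g) :
    DifferentiableOn ℂ (cauchyInt η g) (range η)ᶜ := fun _ hz =>
  (hasDerivAt_parametric_intervalIntegral hη.isOpen_compl_range (hη.continuousOn_cauchyKernel hg)
    (hη.differentiableOn_cauchyKernel g) 0 (2 * Real.pi) hz).differentiableAt.differentiableWithinAt

/-- Differentiation gives the integrand `η' / (η - z)²`, which has the periodic primitive `-1 / (η -
z)`. Local constancy of winding numbers follows without knowing that they are integers. -/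
theorem deriv_cauchyInt_one (hη : IsLoop η) {z : ℂ} (hz : z ∉ range η) :
    deriv (cauchyInt η fun _ => 1) z = 0 := by
  have h := (hasDerivAt_parametric_intervalIntegral hη.isOpen_compl_range
    (hη.continuousOn_cauchyKernel (continuous_const (y := 1)))
    (hη.differentiableOn_cauchyKernel fun _ => 1) 0 (2 * Real.pi) hz).deriv
  refine Eq.trans h ?_
  have h1 : ∀ t, deriv (fun w => (1 : ℂ) * (deriv η t / (η t - w))) z
      = deriv η t / (η t - z) ^ 2 := by
    intro t
    have hne := hη.sub_ne_zero_of_notMem hz t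
    have h2 := (((hasDerivAt_id z).const_sub (η t)).fun_inv hne).const_mul (deriv η t)
    have h3 : (fun w => (1 : ℂ) * (deriv η t / (η t - w)))
        = fun w => deriv η t * (η t - id w)⁻¹ := by
      funext w; simp [div_eq_mul_inv]
    rw [h3, h2.deriv]
    simp [div_eq_mul_inv]
  simp only [h1]
  have h4 : ∀ t ∈ uIcc 0 (2 * Real.pi),
      HasDerivAt (fun t => -(η t - z)⁻¹) (deriv η t / (η t - z) ^ 2) t := by
    intro t _
    have := (((hη.hasDerivAt t).sub_const z).fun_inv (hη.sub_ne_zero_of_notMem hz t)).neg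
    refine this.congr_deriv ?_
    simp [neg_div]
  rw [intervalIntegral.integral_eq_sub_of_hasDerivAt h4]
  · have := hη.periodic 0
    rw [zero_add] at this
    simp [this]
  · refine Continuous.intervalIntegrable ?_ _ _
    exact hη.continuous_deriv.div ((hη.continuous.sub continuous_const).pow 2)
      fun t => pow_ne_zero 2 (hη.sub_ne_zero_of_notMem hz t)

theorem windingNumber_eq_of_isPreconnected (hη : IsLoop η) {U : Set ℂ} (hU : IsOpen U)
    (hUc : IsPreconnected U) (hd : Disjoint U (range η)) {z w : ℂ} (hz : z ∈ U) (hw : w ∈ U) :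
    windingNumber η z = windingNumber η w := by
  have hsub : U ⊆ (range η)ᶜ := hd.subset_compl_right
  rw [windingNumber_eq_cauchyInt, windingNumber_eq_cauchyInt,
    hU.is_const_of_deriv_eq_zero hUc
      ((hη.differentiableOn_cauchyInt continuous_const).mono hsub)
      (fun x hx => hη.deriv_cauchyInt_one (hsub hx)) hz hw]

theorem continuousOn_windingNumber (hη : IsLoop η) : ContinuousOn (windingNumber η) (range η)ᶜ := by
  have := (hη.differentiableOn_cauchyInt (continuous_const (y := 1))).continuousOn
  refine (ContinuousOn.mul continuousOn_const this).congr fun z _ => windingNumber_eq_cauchyInt η z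

theorem tendsto_cauchyInt_cobounded (hη : IsLoop η) {g : ℝ → ℂ} (hg : Continuous g)
    (hgp : Function.Periodic g (2 * Real.pi)) :
    Tendsto (cauchyInt η g) (Bornology.cobounded ℂ) (𝓝 0) := by
  obtain ⟨R, hR, hηR⟩ := hη.periodic.exists_norm_le hη.continuous
  obtain ⟨B, hB, hgB⟩ := hgp.exists_norm_le hg
  obtain ⟨C, hC, hηC⟩ := hη.periodic.deriv_periodic.exists_norm_le hη.continuous_deriv
  have h1 : Tendsto (fun z : ℂ => B * C * (2 * Real.pi) * (‖z‖ - R)⁻¹) (Bornology.cobounded ℂ)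
      (𝓝 0) := by
    have h2 : Tendsto (fun z : ℂ => ‖z‖ - R) (Bornology.cobounded ℂ) atTop :=
      tendsto_atTop_add_const_right _ _ tendsto_norm_cobounded_atTop
    simpa using (tendsto_inv_atTop_zero.comp h2).const_mul (B * C * (2 * Real.pi))
  refine squeeze_zero_norm' ?_ h1
  filter_upwards [tendsto_norm_cobounded_atTop.eventually_gt_atTop R] with z hz
  have hz' : 0 < ‖z‖ - R := sub_pos.2 hz
  have := intervalIntegral.norm_integral_le_of_norm_le_const (a := 0) (b := 2 * Real.pi)
    (f := fun t => g t * (deriv η t / (η t - z))) (C := B * (C * (‖z‖ - R)⁻¹)) ?_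
  · rw [sub_zero, abs_of_pos Real.two_pi_pos] at this
    refine this.trans (le_of_eq (by ring))
  · intro t _
    have h3 : ‖z‖ - R ≤ ‖η t - z‖ := by
      have := norm_sub_norm_le z (η t)
      rw [norm_sub_rev] at this
      linarith [hηR t]
    rw [norm_mul, norm_div, div_eq_mul_inv]
    have h4 : ‖η t - z‖⁻¹ ≤ (‖z‖ - R)⁻¹ := inv_anti₀ hz' h3
    gcongr
    exacts [hgB t, hηC t]

theorem tendsto_windingNumber_cobounded (hη : IsLoop η) :
    Tendsto (windingNumber η) (Bornology.cobounded ℂ) (𝓝 0) := by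
  have := (hη.tendsto_cauchyInt_cobounded (continuous_const (y := 1))
    (fun _ => rfl)).const_mul (2 * (Real.pi : ℂ) * I)⁻¹
  rw [mul_zero] at this
  exact this.congr fun z => (windingNumber_eq_cauchyInt η z).symm

/-- Rouché-type stability: the winding number does not change under a perturbation of the curve
that is smaller than the distance to the point. -/
theorem windingNumber_eq_of_norm_sub_lt (hη : IsLoop η) {ζ : ℝ → ℂ} (hζ : IsLoop ζ) {z : ℂ}
    (h : ∀ t, ‖ζ t - η t‖ < ‖η t - z‖) : windingNumber ζ z = windingNumber η z := by
  have hne : ∀ t, η t - z ≠ 0 := fun t => norm_pos_iff.1 ((norm_nonneg _).trans_lt (h t))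
  have hne' : ∀ t, ζ t - z ≠ 0 := by
    intro t h0
    have := h t
    rw [sub_eq_zero.1 h0, norm_sub_rev] at this
    exact lt_irrefl _ this
  -- The quotient stays within distance 1 of the point 1, so its principal logarithm is a closed
  -- primitive for the difference of the two integrands.
  have hslit : ∀ t, (ζ t - z) / (η t - z) ∈ slitPlane := by
    intro t
    have h1 : ‖(ζ t - z) / (η t - z) - 1‖ < 1 := by
      rw [div_sub_one (hne t), norm_div, div_lt_one (norm_pos_iff.2 (hne t)), sub_sub_sub_cancel_right]
      exact h t
    left
    have h2 := (abs_re_le_norm _).trans_lt h1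
    rw [sub_re, one_re, abs_lt] at h2
    linarith [h2.1]
  have hi : ∀ {ξ : ℝ → ℂ}, IsLoop ξ → (∀ t, ξ t - z ≠ 0) →
      IntervalIntegrable (fun t => deriv ξ t / (ξ t - z)) MeasureTheory.volume 0 (2 * Real.pi) :=
    fun hξ hx => (hξ.continuous_deriv.div (hξ.continuous.sub continuous_const)
      hx).intervalIntegrable _ _
  unfold windingNumber
  congr 1
  rw [← sub_eq_zero, ← intervalIntegral.integral_sub (hi hζ hne') (hi hη hne)]
  have hd : ∀ t ∈ uIcc 0 (2 * Real.pi),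
      HasDerivAt (fun t => Complex.log ((ζ t - z) / (η t - z)))
        (deriv ζ t / (ζ t - z) - deriv η t / (η t - z)) t := by
    intro t _
    have h3 := ((((hζ.hasDerivAt t).sub_const z).div ((hη.hasDerivAt t).sub_const z)
      (hne t))).clog_real (hslit t)
    convert h3 using 1
    simp only [Pi.div_apply]
    have h4 : ∀ a b : ℂ, a ≠ 0 → b ≠ 0 → ∀ c d : ℂ, c / a - d / b
        = (c * b - a * d) / b ^ 2 / (a / b) := by
      intro a b ha hb c d
      field_simp
    exact h4 _ _ (hne' t) (hne t) _ _
  rw [intervalIntegral.integral_eq_sub_of_hasDerivAt hd ((hi hζ hne').sub (hi hη hne))]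
  have h1 := hζ.periodic 0
  have h2 := hη.periodic 0
  rw [zero_add] at h1 h2
  rw [h1, h2, sub_self]

end IsLoop

/-! ### Dixon's form of Cauchy's theorem -/

/-- Strict differentiability controls the difference quotient as both points move; Dixon's kernel
needs this joint continuity at the diagonal. -/
theorem continuousAt_dslope_diag {f : ℂ → ℂ} {G : Set ℂ} (hG : IsOpen G)
    (hf : DifferentiableOn ℂ f G) {a : ℂ} (ha : a ∈ G) :
    ContinuousAt (Function.uncurry (dslope f)) (a, a) := by
  have han : AnalyticAt ℂ f a := hf.analyticAt (hG.mem_nhds ha)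
  have hs := han.hasStrictDerivAt
  rw [Metric.continuousAt_iff']
  intro ε hε
  have h1 := (hs.isLittleO.def (half_pos hε))
  have h2 : ∀ᶠ p : ℂ × ℂ in 𝓝 (a, a), dist (deriv f p.1) (deriv f a) < ε :=
    (continuous_fst.tendsto (a, a)).eventually
      (Metric.continuousAt_iff'.1 han.deriv.continuousAt ε hε)
  filter_upwards [h1, h2] with p hp hp2
  obtain ⟨x, y⟩ := p
  simp only [Function.uncurry_apply_pair, dslope_same]
  rcases eq_or_ne y x with rfl | hne
  · simpa [dslope_same] using hp2
  · rw [dslope_of_ne _ hne, dist_eq_norm, slope_def_field]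
    have hxy : x - y ≠ 0 := sub_ne_zero.2 hne.symm
    have h3 : (f y - f x) / (y - x) - deriv f a
        = (f x - f y - (x - y) * deriv f a) / (x - y) := by
      rw [eq_div_iff hxy, sub_mul, div_mul_eq_mul_div, div_sub' (sub_ne_zero.2 hne)]
      rw [div_eq_iff (sub_ne_zero.2 hne)]
      ring
    rw [h3, norm_div, div_lt_iff₀ (norm_pos_iff.2 hxy)]
    simp only [ContinuousLinearMap.toSpanSingleton_apply, smul_eq_mul] at hp
    have := norm_pos_iff.2 hxy
    calc _ ≤ ε / 2 * ‖x - y‖ := hp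
      _ < ε * ‖x - y‖ := by gcongr; linarith

theorem continuousOn_dslope_uncurry {f : ℂ → ℂ} {G : Set ℂ} (hG : IsOpen G)
    (hf : DifferentiableOn ℂ f G) : ContinuousOn (Function.uncurry (dslope f)) (G ×ˢ G) := by
  rintro ⟨a, b⟩ ⟨ha, hb⟩
  apply ContinuousAt.continuousWithinAt
  rcases eq_or_ne b a with rfl | hne
  · exact continuousAt_dslope_diag hG hf hb
  · have h1 : ContinuousAt (fun p : ℂ × ℂ => (f p.2 - f p.1) / (p.2 - p.1)) (a, b) := by
      have hfa := (hf.differentiableAt (hG.mem_nhds ha)).continuousAt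
      have hfb := (hf.differentiableAt (hG.mem_nhds hb)).continuousAt
      exact ((ContinuousAt.comp (f := Prod.snd) (x := (a, b)) hfb continuousAt_snd).sub
        (ContinuousAt.comp (f := Prod.fst) (x := (a, b)) hfa continuousAt_fst)).div
        (continuousAt_snd.sub continuousAt_fst) (sub_ne_zero.2 hne)
    refine h1.congr ?_
    have h2 : ∀ᶠ p : ℂ × ℂ in 𝓝 (a, b), p.2 ≠ p.1 :=
      (isOpen_ne_fun continuous_snd continuous_fst).mem_nhds hne
    filter_upwards [h2] with p hp
    rw [Function.uncurry_def]
    simp only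
    rw [dslope_of_ne _ hp, slope_def_field]

/-- **Cauchy's theorem** in Dixon's form, for the exterior of a cycle: if `f` is analytic in `G` and
vanishes at infinity and the cycle `∑ ζ j` in `G` winds `-1` times around every point outside `G`,
then the Cauchy integral of `f` along the cycle vanishes outside `G`. -/
theorem sum_cauchyInt_eq_zero {ι : Type*} [Fintype ι] {G : Set ℂ} (hG : IsOpen G) {f : ℂ → ℂ}
    (hf : DifferentiableOn ℂ f G) (hinf : Tendsto f (Bornology.cobounded ℂ) (𝓝 0))
    {ζ : ι → ℝ → ℂ} (hζ : ∀ j, IsLoop (ζ j)) (hmem : ∀ j t, ζ j t ∈ G)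
    (hw : ∀ z ∉ G, ∑ j, windingNumber (ζ j) z = -1) {z : ℂ} (hz : z ∉ G) :
    ∑ j, cauchyInt (ζ j) (fun t => f (ζ j t)) z = 0 := by
  classical
  have hfζ : ∀ j, Continuous fun t => f (ζ j t) := fun j =>
    hf.continuousOn.comp_continuous (hζ j).continuous (hmem j)
  set S : Set ℂ := ⋃ j, range (ζ j) with hS
  have hSc : IsCompact S := isCompact_iUnion fun j => (hζ j).isCompact_range
  have hSG : S ⊆ G := iUnion_subset fun j => range_subset_iff.2 (hmem j)
  have hnS : ∀ {w j}, w ∉ S → w ∉ range (ζ j) := fun hw h => hw (mem_iUnion.2 ⟨_, h⟩)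
  set C : ℂ → ℂ := fun w => ∑ j, cauchyInt (ζ j) (fun t => f (ζ j t)) w with hC
  set W : ℂ → ℂ := fun w => ∑ j, windingNumber (ζ j) w with hW
  -- The difference quotient removes the singularity on the cycle, so `D` is analytic in all of `G`.
  -- The term `-2πi f` makes `D` agree with `C` wherever the total winding number is `-1`.
  set D : ℂ → ℂ := fun w => ∑ j, (∫ t in (0 : ℝ)..2 * Real.pi, dslope f (ζ j t) w * deriv (ζ j) t)
    - 2 * (Real.pi : ℂ) * I * f w with hD
  have hDC : ∀ w, w ∉ S → D w = C w - 2 * (Real.pi : ℂ) * I * f w * (W w + 1) := by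
    intro w hwS
    have h1 : ∀ j, (∫ t in (0 : ℝ)..2 * Real.pi, dslope f (ζ j t) w * deriv (ζ j) t)
        = cauchyInt (ζ j) (fun t => f (ζ j t)) w
          - 2 * (Real.pi : ℂ) * I * f w * windingNumber (ζ j) w := by
      intro j
      have hne := (hζ j).sub_ne_zero_of_notMem (hnS hwS)
      rw [mul_right_comm, ← cauchyInt_one]
      unfold cauchyInt
      rw [mul_comm _ (f w), ← intervalIntegral.integral_const_mul, ← intervalIntegral.integral_sub]
      · refine intervalIntegral.integral_congr fun t _ => ?_
        have h2 : w ≠ ζ j t := fun h => hne t (sub_eq_zero.2 h.symm)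
        simp only
        rw [dslope_of_ne _ h2, slope_def_field]
        have h3 := hne t
        have h4 : w - ζ j t ≠ 0 := sub_ne_zero.2 h2
        field_simp
        ring
      · exact ((hfζ j).mul ((hζ j).continuous_deriv.div
          ((hζ j).continuous.sub continuous_const) hne)).intervalIntegrable _ _
      · exact (continuous_const.mul (continuous_const.mul ((hζ j).continuous_deriv.div
          ((hζ j).continuous.sub continuous_const) hne))).intervalIntegrable _ _
    simp only [hD, hC, hW, h1, Finset.sum_sub_distrib, ← Finset.mul_sum]
    ring
  -- Gluing `D` and `C` gives an entire function tending to 0 at infinity, hence zero by Liouville;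
  -- outside `G` it is the desired sum.
  set h : ℂ → ℂ := fun w => if w ∈ G then D w else C w with hh
  have hdiff : Differentiable ℂ h := by
    intro w
    by_cases hwG : w ∈ G
    · have hDd : DifferentiableAt ℂ D w := by
        refine DifferentiableAt.sub (DifferentiableAt.fun_sum fun j _ => ?_)
          ((hf.differentiableAt (hG.mem_nhds hwG)).const_mul _)
        refine (hasDerivAt_parametric_intervalIntegral
          (F := fun z t => dslope f (ζ j t) z * deriv (ζ j) t) hG ?_ ?_ 0
          (2 * Real.pi) hwG).differentiableAt
        · refine ContinuousOn.mul ?_ ((hζ j).continuous_deriv.comp continuous_snd).continuousOn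
          refine (continuousOn_dslope_uncurry hG hf).comp
            (f := fun p : ℂ × ℝ => (ζ j p.2, p.1)) ?_ ?_
          · exact (((hζ j).continuous.comp continuous_snd).prodMk continuous_fst).continuousOn
          · rintro ⟨x, t⟩ ⟨hx, -⟩
            exact ⟨hmem j t, hx⟩
        · intro t
          exact ((differentiableOn_dslope (hG.mem_nhds (hmem j t))).2 hf).mul_const _
      refine hDd.congr_of_eventuallyEq ?_
      filter_upwards [hG.mem_nhds hwG] with x hx
      simp [hh, hx]
    · have hwS : w ∉ S := fun h => hwG (hSG h)
      obtain ⟨r, hr, hball⟩ := Metric.isOpen_iff.1 hSc.isClosed.isOpen_compl w hwS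
      have hCd : DifferentiableAt ℂ C w := by
        refine DifferentiableAt.fun_sum fun j _ => ?_
        exact ((hζ j).differentiableOn_cauchyInt (hfζ j)).differentiableAt
          ((hζ j).isOpen_compl_range.mem_nhds (hnS hwS))
      refine hCd.congr_of_eventuallyEq ?_
      filter_upwards [Metric.ball_mem_nhds w hr] with x hx
      by_cases hxG : x ∈ G
      -- The ball avoids the cycle, so the winding number `-1` at its centre persists throughout,
      -- and the two definitions match.
      · have hWx : W x = -1 := by
          rw [← hw w hwG]
          refine Finset.sum_congr rfl fun j _ => ?_
          exact (hζ j).windingNumber_eq_of_isPreconnected Metric.isOpen_ball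
            (convex_ball w r).isPreconnected
            (disjoint_left.2 fun y hy hy' => hnS (hball hy) hy') hx (Metric.mem_ball_self hr)
        simp only [hh, hxG, if_true]
        rw [hDC x (hball hx), hWx]
        ring
      · simp [hh, hxG]
  have hlim : Tendsto h (Bornology.cobounded ℂ) (𝓝 0) := by
    have hClim : Tendsto C (Bornology.cobounded ℂ) (𝓝 0) := by
      have := tendsto_finsetSum Finset.univ fun j (_ : j ∈ Finset.univ) =>
        (hζ j).tendsto_cauchyInt_cobounded (hfζ j) ((hζ j).periodic.comp f)
      simpa using this
    have hWlim : Tendsto W (Bornology.cobounded ℂ) (𝓝 0) := by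
      have := tendsto_finsetSum Finset.univ fun j (_ : j ∈ Finset.univ) =>
        (hζ j).tendsto_windingNumber_cobounded
      simpa using this
    have h1 : Tendsto (fun w => C w - 2 * (Real.pi : ℂ) * I * f w * (W w + 1))
        (Bornology.cobounded ℂ) (𝓝 0) := by
      have := hClim.sub ((hinf.const_mul (2 * (Real.pi : ℂ) * I)).mul (hWlim.add_const 1))
      simpa using this
    have h2 : Tendsto (fun w => if w ∈ G then C w - 2 * (Real.pi : ℂ) * I * f w * (W w + 1)
        else C w) (Bornology.cobounded ℂ) (𝓝 0) := h1.if' hClim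
    refine h2.congr' ?_
    have h3 : ∀ᶠ w in Bornology.cobounded ℂ, w ∉ S := hSc.isBounded
    filter_upwards [h3] with w hwS
    simp only [hh, hDC w hwS]
  have h0 := hdiff.apply_eq_of_tendsto_cocompact z (c := 0)
    (by rwa [← Metric.cobounded_eq_cocompact])
  simpa [hh, hz] using h0

/-! ### Regular simple closed curves -/

/-- A twice continuously differentiable simple closed curve with nonvanishing derivative,
parametrized with period `2π`. -/
structure IsRegularLoop (η : ℝ → ℂ) : Prop where
  periodic : Function.Periodic η (2 * Real.pi)
  contDiff : ContDiff ℝ 2 η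
  deriv_ne_zero : ∀ t, deriv η t ≠ 0
  simple : InjOn η (Ico 0 (2 * Real.pi))

/-- The curve `η` shifted along its (left) normal field `i η'`. -/
def normalShift (η : ℝ → ℂ) (x t : ℝ) : ℂ := η t + x * (I * deriv η t)

theorem normalShift_zero (η : ℝ → ℂ) (t : ℝ) : normalShift η 0 t = η t := by simp [normalShift]

namespace IsRegularLoop

variable {η : ℝ → ℂ}

theorem isLoop (hη : IsRegularLoop η) : IsLoop η := ⟨hη.periodic, hη.contDiff.of_le one_le_two⟩

theorem contDiff_deriv (hη : IsRegularLoop η) : ContDiff ℝ 1 (deriv η) :=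
  ((contDiff_succ_iff_deriv (n := 1)).1 hη.contDiff).2.2

theorem continuous_deriv_deriv (hη : IsRegularLoop η) : Continuous (deriv (deriv η)) :=
  hη.contDiff_deriv.continuous_deriv le_rfl

theorem hasDerivAt_deriv (hη : IsRegularLoop η) (t : ℝ) :
    HasDerivAt (deriv η) (deriv (deriv η) t) t :=
  (hη.contDiff_deriv.differentiable one_ne_zero t).hasDerivAt

theorem continuous_normalShift (hη : IsRegularLoop η) :
    Continuous fun p : ℝ × ℝ => normalShift η p.1 p.2 := by
  have h1 := hη.isLoop.continuous
  have h2 := hη.isLoop.continuous_deriv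
  unfold normalShift
  fun_prop

theorem isLoop_normalShift (hη : IsRegularLoop η) (x : ℝ) : IsLoop (normalShift η x) := by
  refine ⟨fun t => ?_, ?_⟩
  · rw [normalShift, hη.periodic, hη.periodic.deriv_periodic, normalShift]
  · have h1 := hη.contDiff_deriv
    have h2 := hη.isLoop.contDiff
    unfold normalShift
    fun_prop

theorem deriv_normalShift (hη : IsRegularLoop η) (x t : ℝ) :
    deriv (normalShift η x) t = deriv η t + x * (I * deriv (deriv η) t) :=
  ((hη.isLoop.hasDerivAt t).add (((hη.hasDerivAt_deriv t).const_mul I).const_mul (x : ℂ))).deriv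

theorem eq_of_abs_sub_lt (hη : IsRegularLoop η) {s t : ℝ} (h : |t - s| < 2 * Real.pi)
    (heq : η t = η s) : t = s := by
  have h1 : ∀ u, η (toIcoMod Real.two_pi_pos 0 u) = η u := fun u => by
    rw [toIcoMod]; exact hη.periodic.sub_zsmul_eq _
  have h2 : ∀ u, toIcoMod Real.two_pi_pos 0 u ∈ Ico 0 (2 * Real.pi) := fun u => by
    simpa using toIcoMod_mem_Ico Real.two_pi_pos 0 u
  have h3 := hη.simple (h2 t) (h2 s) (by rw [h1, h1, heq])
  rw [toIcoMod, toIcoMod] at h3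
  set a := toIcoDiv Real.two_pi_pos 0 t
  set b := toIcoDiv Real.two_pi_pos 0 s
  have h4 : t - s = ((a - b : ℤ) : ℝ) * (2 * Real.pi) := by
    rw [zsmul_eq_mul, zsmul_eq_mul] at h3
    push_cast
    linarith
  rw [h4, abs_mul, abs_of_pos Real.two_pi_pos, mul_lt_iff_lt_one_left Real.two_pi_pos] at h
  have h5 : a - b = 0 := by
    rw [← Int.abs_lt_one_iff]
    exact_mod_cast h
  rw [h5] at h4
  simp at h4
  linarith

theorem exists_abs_sub_le_pi (hη : IsRegularLoop η) (s t : ℝ) :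
    ∃ u, |u - s| ≤ Real.pi ∧ η u = η t ∧ deriv η u = deriv η t := by
  refine ⟨toIcoMod Real.two_pi_pos (s - Real.pi) t, ?_, ?_, ?_⟩
  · have := toIcoMod_mem_Ico Real.two_pi_pos (s - Real.pi) t
    rw [abs_le]
    constructor <;> linarith [this.1, this.2]
  · rw [toIcoMod]; exact hη.periodic.sub_zsmul_eq _
  · rw [toIcoMod]; exact hη.periodic.deriv_periodic.sub_zsmul_eq _

theorem exists_norm_sub_sub_le (hη : IsRegularLoop η) :
    ∃ C, 0 < C ∧ ∀ s t, ‖η t - η s - (t - s) * deriv η s‖ ≤ C * |t - s| ^ 2 := by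
  obtain ⟨C, hC, hCb⟩ := hη.periodic.deriv_periodic.deriv_periodic.exists_norm_le
    hη.continuous_deriv_deriv
  refine ⟨C, hC, fun s t => ?_⟩
  have h1 : ∀ u, ‖deriv η u - deriv η s‖ ≤ C * |u - s| := fun u =>
    convex_univ.norm_image_sub_le_of_norm_hasDerivWithin_le
      (fun x _ => (hη.hasDerivAt_deriv x).hasDerivWithinAt) (fun x _ => hCb x)
      (mem_univ s) (mem_univ u)
  have h2 : ∀ u, HasDerivAt (fun u : ℝ => η u - (u - s) * deriv η s)
      (deriv η u - deriv η s) u := by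
    intro u
    have h3 := ((hasDerivAt_id u).ofReal_comp.sub_const (s : ℂ)).mul_const (deriv η s)
    exact ((hη.isLoop.hasDerivAt u).sub h3).congr_deriv (by simp)
  have h4 := (convex_uIcc s t).norm_image_sub_le_of_norm_hasDerivWithin_le
    (C := C * |t - s|) (fun x _ => (h2 x).hasDerivWithinAt)
    (fun x hx => (h1 x).trans (by gcongr C * ?_; exact abs_sub_left_of_mem_uIcc hx))
    left_mem_uIcc right_mem_uIcc
  simp only [sub_self, zero_mul, sub_zero, Real.norm_eq_abs] at h4
  calc _ = ‖η t - (t - s) * deriv η s - η s‖ := by congr 1; ring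
    _ ≤ _ := h4
    _ = _ := by ring

/-- The curve stays away from the points of its normals. -/
theorem exists_le_norm_sub_normalShift (hη : IsRegularLoop η) :
    ∃ c > 0, ∃ δ > 0, ∀ s t x, |t - s| ≤ Real.pi → |x| ≤ δ →
      c * (|t - s| + |x|) ≤ ‖η t - normalShift η x s‖ := by
  obtain ⟨C, hC, hCb⟩ := hη.exists_norm_sub_sub_le
  have hdc := hη.isLoop.continuous_deriv
  have hc := hη.isLoop.continuous
  obtain ⟨m, hm, hmb⟩ := Function.Periodic.exists_pos_le (f := fun t => ‖deriv η t‖)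
    (hη.periodic.deriv_periodic.comp norm) hdc.norm fun t => norm_pos_iff.2 (hη.deriv_ne_zero t)
  obtain ⟨M, hM, hMb⟩ := hη.periodic.deriv_periodic.exists_norm_le hdc
  -- For `|t - s| ≤ ρ` the Taylor remainder is at most `m / 4 * |t - s|`, half of the lower bound
  -- for the linear term.
  set ρ := m / (4 * C) with hρ
  have hρ0 : 0 < ρ := by positivity
  -- For parameters at distance between `ρ` and `π`, simplicity and compactness bound the chord from
  -- below.
  obtain ⟨c₀, hc₀, hc₀b⟩ : ∃ c₀ > 0, ∀ s t, ρ ≤ |t - s| → |t - s| ≤ Real.pi →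
      c₀ ≤ ‖η t - η s‖ := by
    have hK : IsCompact ((Icc 0 (2 * Real.pi) ×ˢ (Icc (-Real.pi) Real.pi)) ∩
        {p : ℝ × ℝ | ρ ≤ |p.2|}) :=
      (isCompact_Icc.prod isCompact_Icc).inter_right
        (isClosed_le continuous_const continuous_snd.abs)
    have hf : Continuous fun p : ℝ × ℝ => ‖η (p.1 + p.2) - η p.1‖ := by fun_prop
    obtain ⟨c₀, hc₀, h⟩ := hK.exists_forall_le' hf.continuousOn (a := 0) (by
      rintro ⟨s, u⟩ ⟨⟨-, hu⟩, hu2⟩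
      refine norm_pos_iff.2 (sub_ne_zero.2 fun h => ?_)
      simp only [mem_ofPred_eq, mem_Icc] at hu hu2
      have h1 : |s + u - s| < 2 * Real.pi := by
        rw [add_sub_cancel_left]
        exact (abs_le.2 hu).trans_lt (by linarith [Real.pi_pos])
      have := hη.eq_of_abs_sub_lt h1 h
      rw [add_eq_left] at this
      rw [this, abs_zero] at hu2
      linarith)
    refine ⟨c₀, hc₀, fun s t h1 h2 => ?_⟩
    have h3 : toIcoMod Real.two_pi_pos 0 s ∈ Ico 0 (2 * Real.pi) := by
      simpa using toIcoMod_mem_Ico Real.two_pi_pos 0 s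
    have := h (toIcoMod Real.two_pi_pos 0 s, t - s) ⟨⟨Ico_subset_Icc_self h3, abs_le.1 h2⟩, h1⟩
    simp only [toIcoMod] at this
    rw [hη.periodic.sub_zsmul_eq, sub_add_eq_add_sub, hη.periodic.sub_zsmul_eq,
      add_sub_cancel] at this
    exact this
  -- A shift by at most `δ` moves the base point by at most `c₀ / 2`, so half of the chord bound
  -- survives.
  set δ := min 1 (c₀ / (2 * M)) with hδ
  refine ⟨min (m / 4) (c₀ / (2 * (Real.pi + 1))), by
    have := Real.pi_pos; positivity, δ, by positivity, fun s t x hts hx => ?_⟩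
  have hpi := Real.pi_pos
  have hx0 := abs_nonneg x
  have ht0 := abs_nonneg (t - s)
  rcases le_total ρ |t - s| with h | h
  · have h1 := hc₀b s t h hts
    have h2 : ‖(x : ℂ) * (I * deriv η s)‖ ≤ c₀ / 2 := by
      rw [norm_mul, norm_mul, norm_I, one_mul, norm_real, Real.norm_eq_abs]
      calc |x| * ‖deriv η s‖ ≤ c₀ / (2 * M) * M := by
            gcongr
            exacts [hx.trans (min_le_right _ _), hMb s]
        _ = c₀ / 2 := by field_simp
    have h3 : ‖η t - η s‖ - ‖(x : ℂ) * (I * deriv η s)‖ ≤ ‖η t - normalShift η x s‖ := by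
      rw [normalShift, ← sub_sub]
      exact norm_sub_norm_le _ _
    calc _ ≤ c₀ / (2 * (Real.pi + 1)) * (Real.pi + 1) := by
          gcongr
          exacts [min_le_right _ _, hx.trans (min_le_left _ _)]
      _ = c₀ / 2 := by field_simp
      _ ≤ _ := by linarith
  · have h1 := hCb s t
    have h2 : ‖η t - η s - (t - s) * deriv η s‖ ≤ m / 4 * |t - s| := by
      refine h1.trans ?_
      calc C * |t - s| ^ 2 = C * |t - s| * |t - s| := by ring
        _ ≤ C * ρ * |t - s| := by gcongr
        _ = m / 4 * |t - s| := by rw [hρ]; field_simp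
    -- Tangential and normal displacements are orthogonal: they are the real and imaginary parts of
    -- the factor of `η'(s)`.
    have h4 : m / 2 * (|t - s| + |x|) ≤ ‖((t - s : ℝ) - x * I : ℂ) * deriv η s‖ := by
      have h5 := abs_re_le_norm ((t - s : ℝ) - x * I : ℂ)
      have h6 := abs_im_le_norm ((t - s : ℝ) - x * I : ℂ)
      simp only [sub_re, ofReal_re, mul_re, I_re, mul_zero, ofReal_im, I_im, mul_one, sub_self,
        sub_zero, sub_im, mul_im, add_zero, zero_sub, abs_neg] at h5 h6
      rw [norm_mul]
      have h7 := hmb s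
      calc _ = (|t - s| + |x|) / 2 * m := by ring
        _ ≤ _ := by
          refine mul_le_mul ?_ h7 hm.le (norm_nonneg _)
          linarith
    have h8 : η t - normalShift η x s = ((t - s : ℝ) - x * I : ℂ) * deriv η s
        + (η t - η s - (t - s) * deriv η s) := by
      rw [normalShift]; push_cast; ring
    have h9 : ‖((t - s : ℝ) - x * I : ℂ) * deriv η s‖ - ‖η t - η s - (t - s) * deriv η s‖
        ≤ ‖η t - normalShift η x s‖ := by
      rw [h8]
      have := norm_sub_le_norm_add (((t - s : ℝ) - x * I : ℂ) * deriv η s)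
        (η t - η s - (t - s) * deriv η s)
      exact this
    calc _ ≤ m / 4 * (|t - s| + |x|) := by gcongr; exact min_le_left _ _
      _ ≤ _ := by nlinarith [mul_nonneg hm.le hx0]

theorem exists_normalShift_notMem_range (hη : IsRegularLoop η) :
    ∃ δ > 0, ∀ x s, x ≠ 0 → |x| ≤ δ → normalShift η x s ∉ range η := by
  obtain ⟨c, hc, δ, hδ, h⟩ := hη.exists_le_norm_sub_normalShift
  refine ⟨δ, hδ, fun x s hx hxδ ⟨t, ht⟩ => ?_⟩
  obtain ⟨u, hu, hut, -⟩ := hη.exists_abs_sub_le_pi s t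
  have h1 := h s u x hu hxδ
  rw [hut, ht, sub_self, norm_zero] at h1
  have : 0 < c * (|u - s| + |x|) := by
    have := abs_pos.2 hx
    positivity
  linarith

end IsRegularLoop

/-! ### Truncated Cauchy integrals at a point of the curve -/

/-- The Cauchy integral at the point `η s` of the curve itself, without the parameters at distance
less than `ε` from `s`. -/
def truncCauchyInt (η g : ℝ → ℂ) (s ε : ℝ) : ℂ :=
  ∫ t in (s + ε)..(s + 2 * Real.pi - ε), g t * (deriv η t / (η t - η s))

/-- The integral of `x / u²` over `[x, r]` is `1 - x / r ≤ 1`: a Poisson-type kernel keeps bounded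
mass as `x` tends to 0. -/
theorem norm_integral_le_of_norm_le_div_sq {h : ℝ → ℂ} {x r a b : ℝ} (hx : 0 < x) (hxr : x ≤ r)
    (ha : 0 ≤ a) (hb : 0 ≤ b) (hh : ∀ u ∈ Icc x r, ‖h u‖ ≤ a * (x / u ^ 2) + b) :
    ‖∫ u in x..r, h u‖ ≤ a + b * r := by
  have hne : ∀ u ∈ uIcc x r, u ≠ 0 := fun u hu => by
    rw [uIcc_of_le hxr] at hu
    exact (hx.trans_le hu.1).ne'
  have hd : ∀ u ∈ uIcc x r, HasDerivAt (fun u => a * (-(x / u)) + b * u) (a * (x / u ^ 2) + b) u := by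
    intro u hu
    have h1 := (((hasDerivAt_inv (hne u hu)).const_mul x).neg.const_mul a).add
      ((hasDerivAt_id u).const_mul b)
    refine h1.congr_deriv ?_
    simp [div_eq_mul_inv]
  have hi : IntervalIntegrable (fun u => a * (x / u ^ 2) + b) MeasureTheory.volume x r := by
    refine ContinuousOn.intervalIntegrable ?_
    refine (continuousOn_const.mul (continuousOn_const.div (continuousOn_pow 2) ?_)).add
      continuousOn_const
    exact fun u hu => pow_ne_zero 2 (hne u hu)
  have h1 := intervalIntegral.norm_integral_le_of_norm_le hxr
    (Eventually.of_forall fun u hu => hh u (Ioc_subset_Icc_self hu)) hi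
  rw [intervalIntegral.integral_eq_sub_of_hasDerivAt hd hi] at h1
  refine h1.trans ?_
  rw [div_self hx.ne']
  have h2 : 0 ≤ a * (x / r) := by have := hx.trans_le hxr; positivity
  have h3 : 0 ≤ b * x := by positivity
  linarith

theorem Function.Periodic.integral_punctured {F : ℝ → ℂ} (hF : Function.Periodic F (2 * Real.pi))
    {s x : ℝ} (hc : ContinuousOn F (Icc (s + x) (s + 2 * Real.pi - x))) (hxp : x ≤ Real.pi) :
    ∫ t in (s + x)..(s + 2 * Real.pi - x), F t
      = (∫ u in x..Real.pi, F (s + u)) + ∫ u in x..Real.pi, F (s - u) := by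
  have h1 : IntervalIntegrable F MeasureTheory.volume (s + x) (s + Real.pi) := by
    refine (hc.mono ?_).intervalIntegrable
    rw [uIcc_of_le (by linarith)]
    exact Icc_subset_Icc_right (by linarith)
  have h2 : IntervalIntegrable F MeasureTheory.volume (s + Real.pi) (s + 2 * Real.pi - x) := by
    refine (hc.mono ?_).intervalIntegrable
    rw [uIcc_of_le (by linarith)]
    exact Icc_subset_Icc_left (by linarith)
  rw [← intervalIntegral.integral_add_adjacent_intervals h1 h2,
    intervalIntegral.integral_comp_add_left, intervalIntegral.integral_comp_sub_left]
  congr 1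
  have h3 := intervalIntegral.integral_comp_add_right F (2 * Real.pi) (a := s - Real.pi)
    (b := s - x)
  simp only [hF _] at h3
  rw [h3]
  congr 1 <;> ring

namespace IsRegularLoop

variable {η : ℝ → ℂ}

theorem sub_ne_zero (hη : IsRegularLoop η) {s t : ℝ} (h0 : t ≠ s) (h : |t - s| < 2 * Real.pi) :
    η t - η s ≠ 0 := _root_.sub_ne_zero.2 fun heq => h0 (hη.eq_of_abs_sub_lt h heq)

theorem sub_ne_zero_of_mem_Icc (hη : IsRegularLoop η) {s t x : ℝ} (hx : 0 < x)
    (ht : t ∈ Icc (s + x) (s + 2 * Real.pi - x)) : η t - η s ≠ 0 := by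
  refine hη.sub_ne_zero (by linarith [ht.1]) ?_
  rw [abs_lt]
  constructor <;> linarith [ht.1, ht.2, Real.pi_pos]

theorem continuousOn_kernel_punctured (hη : IsRegularLoop η) {g : ℝ → ℂ} (hg : Continuous g)
    {s x : ℝ} (hx : 0 < x) : ContinuousOn (fun t => g t * (deriv η t / (η t - η s)))
      (Icc (s + x) (s + 2 * Real.pi - x)) := by
  refine hg.continuousOn.mul (hη.isLoop.continuous_deriv.continuousOn.div ?_ ?_)
  · exact (hη.isLoop.continuous.sub continuous_const).continuousOn
  · exact fun t ht => hη.sub_ne_zero_of_mem_Icc hx ht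

theorem periodic_kernel (hη : IsRegularLoop η) {g : ℝ → ℂ}
    (hg : Function.Periodic g (2 * Real.pi)) (z : ℂ) :
    Function.Periodic (fun t => g t * (deriv η t / (η t - z))) (2 * Real.pi) := fun t => by
  simp only [hg t, hη.periodic t, hη.periodic.deriv_periodic t]

/-- The Cauchy integral at an interior distance `x` from the curve and the Cauchy integral
truncated at `x` have the same limit if the density vanishes at the base point. -/
theorem tendsto_cauchyInt_sub_truncCauchyInt (hη : IsRegularLoop η) {g : ℝ → ℂ}
    (hg : Continuous g) (hgp : Function.Periodic g (2 * Real.pi)) {s : ℝ} (hgs : g s = 0) :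
    Tendsto (fun x => cauchyInt η g (normalShift η (-x) s) - truncCauchyInt η g s x)
      (𝓝[>] (0 : ℝ)) (𝓝 0) := by
  obtain ⟨c, hc, δ, hδ, hkey⟩ := hη.exists_le_norm_sub_normalShift
  obtain ⟨M, hM, hMb⟩ := hη.periodic.deriv_periodic.exists_norm_le hη.isLoop.continuous_deriv
  obtain ⟨B, hB, hBb⟩ := hgp.exists_norm_le hg
  have hpi := Real.pi_pos
  -- `K` collects the coefficients of `e` in the estimates near `s` and away from it, so the choice
  -- of `e` below makes their total `ε / 2`.
  set K := 2 * M / c + 2 * M ^ 2 / c ^ 2 with hK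
  have hK0 : 0 < K := by positivity
  rw [Metric.tendsto_nhds]
  intro ε hε
  set e := ε / (2 * K) with he
  have he0 : 0 < e := by positivity
  obtain ⟨ρ, hρ, hρb⟩ := Metric.continuousAt_iff.1 (hg.continuousAt (x := s)) e he0
  set B' := B / ρ ^ 2 with hB'
  have hB'0 : 0 < B' := by positivity
  -- Continuity at `s` and boundedness elsewhere are merged into one bound; its quadratic term
  -- cancels the `1 / u²` of the kernel difference.
  have hgb : ∀ t, ‖g t‖ ≤ e + B' * |t - s| ^ 2 := by
    intro t
    rcases lt_or_ge |t - s| ρ with h | h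
    · have := hρb (x := t) (by rwa [Real.dist_eq])
      rw [hgs, dist_zero_right] at this
      have h2 : 0 ≤ B' * |t - s| ^ 2 := by positivity
      linarith
    · calc ‖g t‖ ≤ B := hBb t
        _ = B' * ρ ^ 2 := by rw [hB']; field_simp
        _ ≤ B' * |t - s| ^ 2 := by gcongr
        _ ≤ _ := by linarith
  have hlim : Tendsto (fun x : ℝ => 2 * M * B' / c * x ^ 2 + 2 * (M ^ 2 / c ^ 2 * B' * Real.pi) * x)
      (𝓝[>] 0) (𝓝 0) := by
    have : Continuous fun x : ℝ =>
      2 * M * B' / c * x ^ 2 + 2 * (M ^ 2 / c ^ 2 * B' * Real.pi) * x := by fun_prop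
    simpa using (this.tendsto 0).mono_left nhdsWithin_le_nhds
  filter_upwards [hlim.eventually_lt_const (half_pos hε), self_mem_nhdsWithin,
    nhdsWithin_le_nhds (Iic_mem_nhds hδ), nhdsWithin_le_nhds (Iio_mem_nhds hpi)]
    with x hxlim hx0 hxδ hxp
  rw [mem_Ioi] at hx0
  rw [mem_Iic] at hxδ
  rw [mem_Iio] at hxp
  rw [dist_zero_right]
  set z := normalShift η (-x) s with hz
  have hkx : ∀ t, |t - s| ≤ Real.pi → c * (|t - s| + x) ≤ ‖η t - z‖ := fun t ht => by
    have := hkey s t (-x) ht (by rwa [abs_neg, abs_of_pos hx0])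
    rwa [abs_neg, abs_of_pos hx0] at this
  have hk0 : ∀ t, |t - s| ≤ Real.pi → c * |t - s| ≤ ‖η t - η s‖ := fun t ht => by
    have := hkey s t 0 ht (by rw [abs_zero]; exact hδ.le)
    rwa [abs_zero, add_zero, normalShift_zero] at this
  have hzr : z ∉ range η := by
    rintro ⟨t, ht⟩
    obtain ⟨u, hu, hut, -⟩ := hη.exists_abs_sub_le_pi s t
    have h1 := hkx u hu
    rw [hut, ht, sub_self, norm_zero] at h1
    have : 0 < c * (|u - s| + x) := by have := abs_nonneg (u - s); positivity
    linarith
  set F : ℝ → ℂ := fun t => g t * (deriv η t / (η t - z)) with hF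
  set F₀ : ℝ → ℂ := fun t => g t * (deriv η t / (η t - η s)) with hF₀
  have hFc : Continuous F := hg.mul (hη.isLoop.continuous_deriv.div
    (hη.isLoop.continuous.sub continuous_const) (hη.isLoop.sub_ne_zero_of_notMem hzr))
  have hFp : Function.Periodic F (2 * Real.pi) := hη.periodic_kernel hgp z
  have hF₀p : Function.Periodic F₀ (2 * Real.pi) := hη.periodic_kernel hgp _
  have hF₀c := hη.continuousOn_kernel_punctured hg (s := s) hx0
  -- splitting off the neighbourhood of `s`
  have hsplit : cauchyInt η g z - truncCauchyInt η g s x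
      = (∫ t in (s - x)..(s + x), F t)
        + ∫ t in (s + x)..(s + 2 * Real.pi - x), (F t - F₀ t) := by
    rw [intervalIntegral.integral_sub (hFc.intervalIntegrable _ _) (by
      refine ContinuousOn.intervalIntegrable ?_
      rw [uIcc_of_le (by linarith)]
      exact hF₀c)]
    have h1 : cauchyInt η g z = ∫ t in (s - x)..(s - x + 2 * Real.pi), F t := by
      have := hFp.intervalIntegral_add_eq 0 (s - x)
      rw [zero_add] at this
      exact this
    rw [h1, ← intervalIntegral.integral_add_adjacent_intervals
      (hFc.intervalIntegrable (s - x) (s + x)) (hFc.intervalIntegrable _ _),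
      show s - x + 2 * Real.pi = s + 2 * Real.pi - x by ring]
    unfold truncCauchyInt
    ring
  have hnear : ‖∫ t in (s - x)..(s + x), F t‖ ≤ 2 * M * e / c + 2 * M * B' / c * x ^ 2 := by
    have := intervalIntegral.norm_integral_le_of_norm_le_const (a := s - x) (b := s + x)
      (f := F) (C := (e + B' * x ^ 2) * (M / (c * x))) fun t ht => ?_
    · refine this.trans (le_of_eq ?_)
      rw [show s + x - (s - x) = 2 * x by ring, abs_of_pos (by positivity)]
      field_simp
    · rw [uIoc_of_le (by linarith)] at ht
      have hts : |t - s| ≤ x := by rw [abs_le]; constructor <;> linarith [ht.1, ht.2]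
      rw [norm_mul, norm_div]
      have h1 : c * x ≤ ‖η t - z‖ := by
        refine le_trans ?_ (hkx t (hts.trans hxp.le))
        gcongr
        linarith [abs_nonneg (t - s)]
      have h2 : 0 < c * x := by positivity
      gcongr
      · exact (hgb t).trans (by gcongr)
      · exact hMb t
  -- The two Cauchy kernels differ by a term of order `x / u²`, since the base points are only
  -- `O(x)` apart.
  have houter : ∀ t u, |t - s| = u → u ∈ Icc x Real.pi →
      ‖F t - F₀ t‖ ≤ M ^ 2 / c ^ 2 * e * (x / u ^ 2) + M ^ 2 / c ^ 2 * B' * x := by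
    intro t u htu hu
    have hu0 : 0 < u := hx0.trans_le hu.1
    have hts : |t - s| ≤ Real.pi := by rw [htu]; exact hu.2
    have h1 : c * u ≤ ‖η t - z‖ := by
      refine le_trans ?_ (hkx t hts)
      rw [htu]
      gcongr
      linarith
    have h2 : c * u ≤ ‖η t - η s‖ := by
      have := hk0 t hts
      rwa [htu] at this
    have hcu : 0 < c * u := by positivity
    have hn1 : η t - z ≠ 0 := norm_pos_iff.1 (hcu.trans_le h1)
    have hn2 : η t - η s ≠ 0 := norm_pos_iff.1 (hcu.trans_le h2)
    have h3 : F t - F₀ t = g t * (deriv η t * (z - η s) / ((η t - z) * (η t - η s))) := by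
      simp only [hF, hF₀]
      field_simp
      ring
    have h4 : ‖z - η s‖ ≤ x * M := by
      rw [hz, normalShift, add_sub_cancel_left, norm_mul, norm_mul, norm_I, one_mul, norm_real,
        norm_neg, Real.norm_of_nonneg hx0.le]
      gcongr
      exact hMb s
    rw [h3, norm_mul, norm_div, norm_mul, norm_mul]
    calc _ ≤ (e + B' * u ^ 2) * (M * (x * M) / (c * u * (c * u))) := by
          have := hgb t
          rw [htu] at this
          gcongr
          exact hMb t
      _ = _ := by field_simp
  have hout : ‖∫ t in (s + x)..(s + 2 * Real.pi - x), (F t - F₀ t)‖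
      ≤ 2 * (M ^ 2 / c ^ 2 * e + M ^ 2 / c ^ 2 * B' * x * Real.pi) := by
    rw [Function.Periodic.integral_punctured (F := fun t => F t - F₀ t)
      (fun t => by simp only [hFp t, hF₀p t]) (hFc.continuousOn.sub hF₀c) hxp.le]
    refine (norm_add_le _ _).trans ?_
    rw [two_mul]
    gcongr
    · refine norm_integral_le_of_norm_le_div_sq hx0 hxp.le (by positivity) (by positivity)
        fun u hu => houter _ _ ?_ hu
      rw [add_sub_cancel_left, abs_of_pos (hx0.trans_le hu.1)]
    · refine norm_integral_le_of_norm_le_div_sq hx0 hxp.le (by positivity) (by positivity)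
        fun u hu => houter _ _ ?_ hu
      rw [sub_sub_cancel_left, abs_neg, abs_of_pos (hx0.trans_le hu.1)]
  have hKe : K * e = ε / 2 := by rw [he]; field_simp
  rw [hsplit]
  calc _ ≤ _ := norm_add_le _ _
    _ ≤ (2 * M * e / c + 2 * M * B' / c * x ^ 2)
      + 2 * (M ^ 2 / c ^ 2 * e + M ^ 2 / c ^ 2 * B' * x * Real.pi) := add_le_add hnear hout
    _ = K * e + (2 * M * B' / c * x ^ 2 + 2 * (M ^ 2 / c ^ 2 * B' * Real.pi) * x) := by
      rw [hK]; ring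
    _ < ε := by rw [hKe]; linarith

/-- The principal value of the Cauchy integral with density `1` at a point of the curve is the mean
of its values on the two sides. -/
theorem tendsto_truncCauchyInt_one (hη : IsRegularLoop η) {s σ : ℝ} (hσ : σ = 1 ∨ σ = -1) {c : ℂ}
    (h : ∀ᶠ x in 𝓝[>] (0 : ℝ), cauchyInt η (fun _ => 1) (normalShift η (σ * x) s) = c) :
    Tendsto (truncCauchyInt η (fun _ => 1) s) (𝓝[>] (0 : ℝ)) (𝓝 (c - σ * (Real.pi * I))) := by
  have hpi := Real.pi_pos
  have hσ2 : (σ : ℂ) * σ = 1 := by rcases hσ with rfl | rfl <;> norm_num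
  have hσ0 : (σ : ℂ) ≠ 0 := left_ne_zero_of_mul_eq_one hσ2
  -- Dividing by `d` turns the normal displacement into the real number `x` and the tangent at `s`
  -- into `σ i`. Near `s` the arc then meets the real axis only at 0, and adding `x > 0` puts it in
  -- the slit plane.
  set d : ℂ := -σ * I * deriv η s with hd
  have hd0 : d ≠ 0 := mul_ne_zero (mul_ne_zero (neg_ne_zero.2 hσ0) I_ne_zero) (hη.deriv_ne_zero s)
  set l : ℝ → ℂ := fun t => (η t - η s) / d with hl
  have hld : HasDerivAt l (σ * I) s := by
    refine (((hη.isLoop.hasDerivAt s).sub_const (η s)).div_const d).congr_deriv ?_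
    rw [div_eq_iff hd0, hd]
    linear_combination deriv η s * I_sq + deriv η s * I ^ 2 * hσ2
  have hls : l s = 0 := by simp [hl]
  have hσi : (σ * I : ℂ).im ≠ 0 := by rcases hσ with rfl | rfl <;> simp
  have hsl1 := hasDerivAt_iff_tendsto_slope.1 hld
  obtain ⟨ε₀, hε₀, him⟩ : ∃ ε₀ > 0, ∀ t, t ≠ s → |t - s| < ε₀ → (l t).im ≠ 0 := by
    have h1 := ((continuous_im.tendsto _).comp hsl1).eventually_ne hσi
    rw [eventually_nhdsWithin_iff, Metric.eventually_nhds_iff] at h1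
    obtain ⟨ε₀, hε₀, h1⟩ := h1
    refine ⟨ε₀, hε₀, fun t hts ht h0 => h1 (by rwa [Real.dist_eq]) hts ?_⟩
    simp [slope_def_module, hls, h0]
  obtain ⟨δ, hδ, hnr⟩ := hη.exists_normalShift_notMem_range
  have hz : ∀ x t, η t - normalShift η (σ * x) s = d * (l t + x) := by
    intro x t
    rw [mul_add, hl, mul_div_cancel₀ _ hd0, normalShift, hd]
    push_cast
    ring
  have hne : ∀ x, 0 < x → x ≤ δ → ∀ t, η t - normalShift η (σ * x) s ≠ 0 := by
    intro x hx hxδ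
    refine hη.isLoop.sub_ne_zero_of_notMem (hnr _ s ?_ ?_)
    · rcases hσ with rfl | rfl <;> simpa using hx.ne'
    · rcases hσ with rfl | rfl <;> simpa [abs_of_pos hx] using hxδ
  have hslit : ∀ ε, 0 < ε → ε < ε₀ → l (s + ε) ∈ slitPlane ∧ l (s - ε) ∈ slitPlane := by
    intro ε hε hε'
    refine ⟨Or.inr (him _ ?_ ?_), Or.inr (him _ ?_ ?_)⟩
    · linarith
    · rwa [add_sub_cancel_left, abs_of_pos hε]
    · linarith
    · rwa [sub_sub_cancel_left, abs_neg, abs_of_pos hε]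
  -- On the short arc `log (l + x)` is a primitive; on the rest there is no singularity. Letting `x
  -- → 0` with `ε` fixed evaluates the truncated integral.
  have hstep : ∀ ε, 0 < ε → ε < ε₀ → ε < Real.pi →
      truncCauchyInt η (fun _ => 1) s ε = c - (log (l (s + ε)) - log (l (s - ε))) := by
    intro ε hε hεε hεp
    have hE1 : ∀ x, 0 < x → x ≤ δ → cauchyInt η (fun _ => 1) (normalShift η (σ * x) s)
        = (log (l (s + ε) + x) - log (l (s - ε) + x))
          + ∫ t in (s + ε)..(s + 2 * Real.pi - ε),
            1 * (deriv η t / (η t - normalShift η (σ * x) s)) := by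
      intro x hx hxδ
      have hFc : Continuous fun t => 1 * (deriv η t / (η t - normalShift η (σ * x) s)) :=
        continuous_const.mul (hη.isLoop.continuous_deriv.div
          (hη.isLoop.continuous.sub continuous_const) (hne x hx hxδ))
      have h1 : cauchyInt η (fun _ => 1) (normalShift η (σ * x) s)
          = ∫ t in (s - ε)..(s - ε + 2 * Real.pi),
            1 * (deriv η t / (η t - normalShift η (σ * x) s)) := by
        have := (hη.periodic_kernel (g := fun _ => 1) (fun _ => rfl)
          (normalShift η (σ * x) s)).intervalIntegral_add_eq 0 (s - ε)
        rw [zero_add] at this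
        exact this
      rw [h1, ← intervalIntegral.integral_add_adjacent_intervals
        (hFc.intervalIntegrable (s - ε) (s + ε)) (hFc.intervalIntegrable _ _),
        show s - ε + 2 * Real.pi = s + 2 * Real.pi - ε by ring]
      congr 1
      refine intervalIntegral.integral_eq_sub_of_hasDerivAt (f := fun t => log (l t + x))
        (fun t ht => ?_) (hFc.intervalIntegrable _ _)
      rw [uIcc_of_le (by linarith)] at ht
      have hsp : l t + x ∈ slitPlane := by
        rcases eq_or_ne t s with rfl | hts
        · left; simpa [hls] using hx
        · right
          rw [add_im, ofReal_im, add_zero]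
          refine him t hts (lt_of_le_of_lt ?_ hεε)
          rw [abs_le]; constructor <;> linarith [ht.1, ht.2]
      have h2 : HasDerivAt (fun t => l t + x) (deriv η t / d) t :=
        (((hη.isLoop.hasDerivAt t).sub_const (η s)).div_const d).add_const _
      refine (h2.clog_real hsp).congr_deriv ?_
      rw [hz, one_mul, div_div]
    have hcw : ContinuousWithinAt (fun x : ℝ => ∫ t in (s + ε)..(s + 2 * Real.pi - ε),
        1 * (deriv η t / (η t - normalShift η (σ * x) s))) (Icc 0 δ) 0 := by
      refine continuousOn_parametric_intervalIntegral ?_ 0 (left_mem_Icc.2 hδ.le)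
      refine continuousOn_const.mul (ContinuousOn.div ?_ ?_ ?_)
      · exact (hη.isLoop.continuous_deriv.comp continuous_snd).continuousOn
      · exact ((hη.isLoop.continuous.comp continuous_snd).sub (hη.continuous_normalShift.comp
          ((continuous_const.mul continuous_fst).prodMk continuous_const))).continuousOn
      · rintro ⟨x, t⟩ ⟨hx, ht⟩
        rcases hx.1.eq_or_lt with h0 | h0
        · simp only at h0
          rw [uIcc_of_le (by linarith)] at ht
          simp only [← h0, mul_zero, normalShift_zero]
          exact hη.sub_ne_zero_of_mem_Icc hε ht
        · exact hne x h0 hx.2 t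
    have hI : Tendsto (fun x : ℝ => ∫ t in (s + ε)..(s + 2 * Real.pi - ε),
        1 * (deriv η t / (η t - normalShift η (σ * x) s))) (𝓝[>] 0)
        (𝓝 (truncCauchyInt η (fun _ => 1) s ε)) := by
      have h1 := hcw.tendsto
      simp only [mul_zero, normalShift_zero] at h1
      exact h1.mono_left (nhdsWithin_le_of_mem (mem_of_superset (Ioc_mem_nhdsGT hδ)
        Ioc_subset_Icc_self))
    have hL : ∀ a ∈ slitPlane, Tendsto (fun x : ℝ => log (a + x)) (𝓝[>] 0) (𝓝 (log a)) := by
      intro a ha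
      have h1 : Tendsto (fun x : ℝ => a + x) (𝓝 0) (𝓝 a) := by
        have h2 : Continuous fun x : ℝ => a + x := by fun_prop
        simpa using h2.tendsto 0
      exact (h1.clog ha).mono_left nhdsWithin_le_nhds
    have hlim := ((hL _ (hslit ε hε hεε).1).sub (hL _ (hslit ε hε hεε).2)).add hI
    have hlim' := hlim.congr' (f₂ := fun _ => c) (by
      filter_upwards [h, Ioc_mem_nhdsGT hδ] with x hx hxδ
      rw [← hx, hE1 x hxδ.1 hxδ.2])
    rw [tendsto_nhds_unique tendsto_const_nhds hlim']
    ring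
  have hright : Tendsto (fun ε : ℝ => l (s + ε) / ε) (𝓝[>] 0) (𝓝 (σ * I)) := by
    have h1 : Tendsto (fun ε : ℝ => s + ε) (𝓝[>] 0) (𝓝[≠] s) := by
      refine tendsto_nhdsWithin_iff.2 ⟨?_, ?_⟩
      · have : Continuous fun ε : ℝ => s + ε := by fun_prop
        simpa using (this.tendsto 0).mono_left nhdsWithin_le_nhds
      · filter_upwards [self_mem_nhdsWithin] with ε hε
        simpa using (mem_Ioi.1 hε).ne'
    refine (hsl1.comp h1).congr fun ε => ?_
    simp [slope_def_module, hls, div_eq_inv_mul]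
  have hleft : Tendsto (fun ε : ℝ => l (s - ε) / ε) (𝓝[>] 0) (𝓝 (-(σ * I))) := by
    have h1 : Tendsto (fun ε : ℝ => s - ε) (𝓝[>] 0) (𝓝[≠] s) := by
      refine tendsto_nhdsWithin_iff.2 ⟨?_, ?_⟩
      · have : Continuous fun ε : ℝ => s - ε := by fun_prop
        simpa using (this.tendsto 0).mono_left nhdsWithin_le_nhds
      · filter_upwards [self_mem_nhdsWithin] with ε hε
        simpa using (mem_Ioi.1 hε).ne'
    refine (hsl1.comp h1).neg.congr fun ε => ?_
    simp [slope_def_module, hls, div_eq_inv_mul]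
  have hlog := (hright.clog (Or.inr hσi)).sub
    (hleft.clog (Or.inr (by rw [neg_im]; exact neg_ne_zero.2 hσi)))
  -- This is the half jump. The two ends of the arc leave in the directions `±σ i`, and the common
  -- term `log ε` cancels in the difference.
  have hval : log (σ * I) - log (-(σ * I)) = σ * (Real.pi * I) := by
    rcases hσ with rfl | rfl
    · simp only [ofReal_one, one_mul, log_I, log_neg_I]; ring
    · simp only [ofReal_neg, ofReal_one, neg_mul, one_mul, neg_neg, log_I, log_neg_I]; ring
  rw [hval] at hlog
  refine (hlog.const_sub c).congr' ?_
  filter_upwards [Ioo_mem_nhdsGT (lt_min hε₀ hpi)] with ε hε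
  have hεε := hε.2.trans_le (min_le_left _ _)
  rw [hstep ε hε.1 hεε (hε.2.trans_le (min_le_right _ _))]
  have hmul : ∀ a : ℂ, a ∈ slitPlane → log a = Real.log ε + log (a / ε) := by
    intro a ha
    have h0 : (ε : ℂ) ≠ 0 := ofReal_ne_zero.2 hε.1.ne'
    rw [← log_ofReal_mul hε.1 (div_ne_zero (slitPlane_ne_zero ha) h0), mul_div_cancel₀ _ h0]
  rw [hmul _ (hslit ε hε.1 hεε).1, hmul _ (hslit ε hε.1 hεε).2]
  ring

end IsRegularLoop

/-- A nearest point on the curve is the foot of a normal. -/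
theorem IsRegularLoop.exists_eq_normalShift {η : ℝ → ℂ} (hη : IsRegularLoop η) (z : ℂ) :
    ∃ x t, z = normalShift η x t ∧ ∀ u, ‖z - η t‖ ≤ ‖z - η u‖ := by
  obtain ⟨w, ⟨t, rfl⟩, ht⟩ := hη.isLoop.isCompact_range.exists_isMinOn (range_nonempty η)
    (f := fun w => ‖z - w‖) (by fun_prop)
  have hmin : ∀ u, ‖z - η t‖ ≤ ‖z - η u‖ := fun u => ht (mem_range_self u)
  have hd := (((hη.isLoop.hasDerivAt t).const_sub z).norm_sq)
  have hloc : IsLocalMin (fun u => ‖z - η u‖ ^ 2) t := Eventually.of_forall fun u => by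
    have := hmin u
    simp only
    gcongr
  have h0 := hloc.hasDerivAt_eq_zero hd
  have hne := hη.deriv_ne_zero t
  set q := (z - η t) / deriv η t with hq
  have hqz : z - η t = q * deriv η t := by rw [hq, div_mul_cancel₀ _ hne]
  -- The first-order condition for the minimal distance says that `z - η t` is orthogonal to the
  -- tangent.
  have hre : q.re = 0 := by
    rw [inner_neg_right, hqz, Complex.inner] at h0
    have h1 : (deriv η t * (starRingEnd ℂ) (q * deriv η t)).re = q.re * normSq (deriv η t) := by
      simp [normSq_apply]; ring
    rw [h1] at h0
    have h2 : normSq (deriv η t) ≠ 0 := fun h => hne (normSq_eq_zero.1 h)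
    have h3 : q.re * normSq (deriv η t) = 0 := by linarith
    exact (mul_eq_zero.1 h3).resolve_right h2
  refine ⟨q.im, t, ?_, hmin⟩
  have h4 : q = q.im * I := by
    apply Complex.ext <;> simp [hre]
  rw [normalShift, ← mul_assoc, ← h4, ← hqz]
  ring

theorem IsLoop.windingNumber_eq_of_mem_closure {η : ℝ → ℂ} (hη : IsLoop η) {S : Set ℂ} {c z : ℂ}
    (hS : ∀ w ∈ S, windingNumber η w = c) (hz : z ∈ closure S) (hzη : z ∉ range η) :
    windingNumber η z = c := by
  have h1 : ContinuousAt (windingNumber η) z :=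
    hη.continuousOn_windingNumber.continuousAt (hη.isOpen_compl_range.mem_nhds hzη)
  have := mem_closure_iff_nhdsWithin_neBot.1 hz
  refine tendsto_nhds_unique (h1.tendsto.mono_left (nhdsWithin_le_nhds (s := S))) ?_
  exact tendsto_const_nhds.congr' (eventually_nhdsWithin_of_forall fun w hw => (hS w hw).symm)

theorem tendsto_normalShift_zero (η : ℝ → ℂ) (t : ℝ) :
    Tendsto (fun x => normalShift η x t) (𝓝 0) (𝓝 (η t)) := by
  have : Continuous fun x : ℝ => normalShift η x t := by unfold normalShift; fun_prop
  simpa [normalShift_zero] using this.tendsto 0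

/-! ### Sides of the boundary curves, winding numbers, and Cauchy's theorem up to the boundary. -/

namespace UnboundedRegion

variable {m : ℕ} (D : UnboundedRegion m)

theorem isRegularLoop (k : Fin m) : IsRegularLoop (D.η k) :=
  ⟨D.periodic k, D.contDiff k, D.deriv_ne_zero k, D.simple k⟩

theorem isLoop (k : Fin m) : IsLoop (D.η k) := (D.isRegularLoop k).isLoop

theorem range_subset_closure (k : Fin m) : range (D.η k) ⊆ closure D.G := by
  refine Subset.trans ?_ frontier_subset_closure
  rw [D.frontier_G]
  exact subset_iUnion (fun k => range (D.η k)) k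

theorem disjoint_G_range (k : Fin m) : Disjoint D.G (range (D.η k)) := by
  have h1 : Disjoint D.G (frontier D.G) :=
    disjoint_iff_inter_eq_empty.2 D.isOpen_G.inter_frontier_eq
  exact h1.mono_right (by rw [D.frontier_G]; exact subset_iUnion (fun k => range (D.η k)) k)

theorem disjoint_closure_Gc (k : Fin m) : Disjoint (closure D.G) (D.Gc k) := by
  rw [← subset_compl_iff_disjoint_left, D.compl_closure_G]
  exact subset_iUnion _ k

theorem disjoint_Gc_range (j k : Fin m) : Disjoint (D.Gc k) (range (D.η j)) :=
  ((D.disjoint_closure_Gc k).mono_left (D.range_subset_closure j)).symm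

theorem mem_closure_Gc (k : Fin m) (s : ℝ) : D.η k s ∈ closure (D.Gc k) := by
  apply frontier_subset_closure
  rw [D.frontier_Gc]
  exact mem_range_self s

theorem mem_closure_G (k : Fin m) (s : ℝ) : D.η k s ∈ closure D.G :=
  D.range_subset_closure k (mem_range_self s)

theorem Gc_nonempty (k : Fin m) : (D.Gc k).Nonempty :=
  closure_nonempty_iff.1 ⟨_, D.mem_closure_Gc k 0⟩

theorem isPreconnected_Gc (k : Fin m) : IsPreconnected (D.Gc k) :=
  (D.simplyConnected_Gc k).isPathConnected.isConnected.isPreconnected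

theorem mem_G_or_mem_Gc_or_mem_range (z : ℂ) :
    z ∈ D.G ∨ (∃ k, z ∈ D.Gc k) ∨ ∃ k, z ∈ range (D.η k) := by
  by_cases hz : z ∈ closure D.G
  · by_cases hG : z ∈ D.G
    · exact Or.inl hG
    · refine Or.inr (Or.inr (mem_iUnion.1 ?_))
      rw [← D.frontier_G, D.isOpen_G.frontier_eq]
      exact ⟨hz, hG⟩
  · refine Or.inr (Or.inl (mem_iUnion.1 ?_))
    rw [← D.compl_closure_G]
    exact hz

/-- The connected set `G` contains a neighbourhood of infinity, where the winding number tends to 0.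
-/
theorem windingNumber_of_mem_G (k : Fin m) {z : ℂ} (hz : z ∈ D.G) :
    windingNumber (D.η k) z = 0 := by
  refine tendsto_nhds_unique ?_ (D.isLoop k).tendsto_windingNumber_cobounded
  refine tendsto_const_nhds.congr' ?_
  have h1 : ∀ᶠ w in Bornology.cobounded ℂ, w ∈ D.G := by
    have := D.infty_mem
    rwa [Bornology.isBounded_def, compl_compl] at this
  filter_upwards [h1] with w hw
  exact (D.isLoop k).windingNumber_eq_of_isPreconnected D.isOpen_G D.isConnected_G.isPreconnected
    (D.disjoint_G_range k) hz hw

theorem windingNumber_of_mem_range {j k : Fin m} (hjk : j ≠ k) (s : ℝ) :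
    windingNumber (D.η j) (D.η k s) = 0 :=
  (D.isLoop j).windingNumber_eq_of_mem_closure (fun _ hw => D.windingNumber_of_mem_G j hw)
    (D.mem_closure_G k s) fun h => disjoint_left.1 (D.disjoint_curves hjk) h (mem_range_self s)

/-- The curve `Γ k` avoids `Γ j` and bounds both `G` and `Gc k`, so by continuity the value 0 passes
from `G` across `Γ k` into the hole. -/
theorem windingNumber_of_mem_Gc {j k : Fin m} (hjk : j ≠ k) {z : ℂ} (hz : z ∈ D.Gc k) :
    windingNumber (D.η j) z = 0 := by
  rw [← D.windingNumber_of_mem_range hjk 0]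
  refine ((D.isLoop j).windingNumber_eq_of_mem_closure (fun w hw => ?_) (D.mem_closure_Gc k 0)
    fun h => disjoint_left.1 (D.disjoint_curves hjk) h (mem_range_self 0)).symm
  exact (D.isLoop j).windingNumber_eq_of_isPreconnected (D.isOpen_Gc k) (D.isPreconnected_Gc k)
    (D.disjoint_Gc_range j k) hw hz

theorem exists_normalShift_notMem_range (k : Fin m) :
    ∃ δ > 0, ∀ x s, x ≠ 0 → |x| < δ → ∀ j, normalShift (D.η k) x s ∉ range (D.η j) := by
  obtain ⟨δ, hδ, h⟩ := (D.isRegularLoop k).exists_normalShift_notMem_range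
  obtain ⟨M, hM, hMb⟩ := (D.periodic k).deriv_periodic.exists_norm_le (D.isLoop k).continuous_deriv
  set K : Set ℂ := ⋃ j : {j // j ≠ k}, range (D.η j) with hK
  have hKc : IsCompact K := isCompact_iUnion fun j => (D.isLoop j).isCompact_range
  have hdis : range (D.η k) ⊆ Kᶜ := by
    rw [subset_compl_iff_disjoint_left, hK, disjoint_iUnion_left]
    exact fun j => D.disjoint_curves j.2
  obtain ⟨r, hr, hrK⟩ := (D.isLoop k).isCompact_range.exists_thickening_subset_open
    hKc.isClosed.isOpen_compl hdis
  refine ⟨min δ (r / M), by positivity, fun x s hx hxδ j hj => ?_⟩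
  rcases eq_or_ne j k with rfl | hjk
  · exact h x s hx (hxδ.le.trans (min_le_left _ _)) hj
  · refine hrK (Metric.mem_thickening_iff.2 ⟨D.η k s, mem_range_self s, ?_⟩)
      (mem_iUnion.2 ⟨⟨j, hjk⟩, hj⟩)
    rw [dist_eq_norm, normalShift, add_sub_cancel_left, norm_mul, norm_mul, norm_I, one_mul,
      norm_real, Real.norm_eq_abs]
    have h1 : |x| * M < r := (lt_div_iff₀ hM).1 (hxδ.trans_le (min_le_right _ _))
    exact lt_of_le_of_lt (by gcongr; exact hMb s) h1

/-- Off the curves the plane is a disjoint union of the open sets `G` and `Gc j`, and a preconnected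
set cannot be split between them. -/
theorem subset_G_or_subset_Gc {U : Set ℂ} (hU : IsPreconnected U) (k : Fin m)
    (hr : ∀ j, Disjoint U (range (D.η j))) :
    ((U ∩ D.G).Nonempty → U ⊆ D.G) ∧ ((U ∩ D.Gc k).Nonempty → U ⊆ D.Gc k) := by
  have hUn : ∀ z ∈ U, z ∈ D.G ∨ ∃ j, z ∈ D.Gc j := by
    intro z hz
    rcases D.mem_G_or_mem_Gc_or_mem_range z with h | h | ⟨j, h⟩
    exacts [Or.inl h, Or.inr h, (disjoint_left.1 (hr j) hz h).elim]
  have hGGc : ∀ j, Disjoint D.G (D.Gc j) := fun j =>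
    (D.disjoint_closure_Gc j).mono_left subset_closure
  constructor
  · intro hne
    refine IsPreconnected.subset_left_of_subset_union D.isOpen_G
      (isOpen_iUnion D.isOpen_Gc) (disjoint_iUnion_right.2 hGGc) (fun z hz => ?_) hne hU
    exact (hUn z hz).imp id mem_iUnion.2
  · intro hne
    refine IsPreconnected.subset_left_of_subset_union (D.isOpen_Gc k)
      (D.isOpen_G.union (isOpen_iUnion fun j : {j // j ≠ k} => D.isOpen_Gc j))
      (disjoint_union_right.2 ⟨(hGGc k).symm, disjoint_iUnion_right.2 fun j =>
        D.disjoint_Gc j.2.symm⟩) (fun z hz => ?_) hne hU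
    rcases hUn z hz with h | ⟨j, h⟩
    · exact Or.inr (Or.inl h)
    · rcases eq_or_ne j k with rfl | hjk
      · exact Or.inl h
      · exact Or.inr (Or.inr (mem_iUnion.2 ⟨⟨j, hjk⟩, h⟩))

/-- The region lies to the left of each boundary curve, the hole to the right. -/
theorem exists_normalShift_mem (k : Fin m) :
    ∃ δ > 0, ∀ x s, 0 < x → x < δ →
      normalShift (D.η k) x s ∈ D.G ∧ normalShift (D.η k) (-x) s ∈ D.Gc k := by
  obtain ⟨δ, hδ, hnr⟩ := D.exists_normalShift_notMem_range k
  have hreg := D.isRegularLoop k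
  obtain ⟨c, hc, hcb⟩ := Function.Periodic.exists_pos_le (f := fun t => ‖deriv (D.η k) t‖)
    ((D.periodic k).deriv_periodic.comp norm) (D.isLoop k).continuous_deriv.norm
    fun t => norm_pos_iff.2 (D.deriv_ne_zero k t)
  set side : Set ℝ → Set ℂ := fun J => (fun p : ℝ × ℝ => normalShift (D.η k) p.1 p.2) '' (J ×ˢ univ)
    with hside
  have hconn : ∀ a b, IsPreconnected (side (Ioo a b)) := fun a b =>
    (isPreconnected_Ioo.prod isPreconnected_univ).image _ hreg.continuous_normalShift.continuousOn
  have hdisj : ∀ J : Set ℝ, (∀ x ∈ J, x ≠ 0 ∧ |x| < δ) → ∀ j, Disjoint (side J) (range (D.η j)) := by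
    rintro J hJ j
    rw [disjoint_left]
    rintro _ ⟨⟨x, s⟩, ⟨hx, -⟩, rfl⟩
    exact hnr x s (hJ x hx).1 (hJ x hx).2 j
  have hJl : ∀ x ∈ Ioo 0 δ, x ≠ 0 ∧ |x| < δ := fun x hx =>
    ⟨hx.1.ne', by rw [abs_of_pos hx.1]; exact hx.2⟩
  have hJr : ∀ x ∈ Ioo (-δ) 0, x ≠ 0 ∧ |x| < δ := fun x hx =>
    ⟨hx.2.ne, by rw [abs_of_neg hx.2]; linarith [hx.1]⟩
  have hL := D.subset_G_or_subset_Gc (hconn 0 δ) k (hdisj _ hJl)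
  have hR := D.subset_G_or_subset_Gc (hconn (-δ) 0) k (hdisj _ hJr)
  -- a set with a boundary point on the curve meets one of the two sides
  have hmeet : ∀ V : Set ℂ, Disjoint V (range (D.η k)) → D.η k 0 ∈ closure V →
      (side (Ioo 0 δ) ∩ V).Nonempty ∨ (side (Ioo (-δ) 0) ∩ V).Nonempty := by
    intro V hV hcl
    obtain ⟨z, hzV, hz⟩ := Metric.mem_closure_iff.1 hcl (c * δ) (by positivity)
    obtain ⟨x, t, hzx, hmin⟩ := hreg.exists_eq_normalShift z
    have h1 : |x| * c < δ * c := by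
      calc |x| * c ≤ |x| * ‖deriv (D.η k) t‖ := by gcongr; exact hcb t
        _ = ‖z - D.η k t‖ := by
          rw [hzx, normalShift, add_sub_cancel_left, norm_mul, norm_mul, norm_I, one_mul,
            norm_real, Real.norm_eq_abs]
        _ ≤ ‖z - D.η k 0‖ := hmin 0
        _ < δ * c := by rwa [dist_comm, dist_eq_norm, mul_comm] at hz
    have h2 := abs_lt.1 (lt_of_mul_lt_mul_right h1 hc.le)
    rcases lt_trichotomy x 0 with h | h | h
    · exact Or.inr ⟨z, ⟨(x, t), ⟨⟨h2.1, h⟩, mem_univ _⟩, hzx.symm⟩, hzV⟩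
    · rw [h, normalShift_zero] at hzx
      exact (disjoint_left.1 hV hzV ⟨t, hzx.symm⟩).elim
    · exact Or.inl ⟨z, ⟨(x, t), ⟨⟨h, h2.2⟩, mem_univ _⟩, hzx.symm⟩, hzV⟩
  have hpos : ∀ x s, 0 < x → x < δ → normalShift (D.η k) x s ∈ side (Ioo 0 δ) :=
    fun x s h1 h2 => ⟨(x, s), ⟨⟨h1, h2⟩, mem_univ _⟩, rfl⟩
  have hneg : ∀ x s, 0 < x → x < δ → normalShift (D.η k) (-x) s ∈ side (Ioo (-δ) 0) :=
    fun x s h1 h2 => ⟨(-x, s), ⟨⟨by linarith, by linarith⟩, mem_univ _⟩, rfl⟩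
  have hGGc : Disjoint D.G (D.Gc k) := (D.disjoint_closure_Gc k).mono_left subset_closure
  have hδ2 : 0 < δ / 2 := by positivity
  have hδ2' : δ / 2 < δ := by linarith
  rcases hmeet D.G (D.disjoint_G_range k) (D.mem_closure_G k 0) with hG | hG <;>
    rcases hmeet (D.Gc k) (D.disjoint_Gc_range k k) (D.mem_closure_Gc k 0) with hGc | hGc
  · exact (disjoint_left.1 hGGc (hL.1 hG (hpos _ 0 hδ2 hδ2')) (hL.2 hGc (hpos _ 0 hδ2 hδ2'))).elim
  · exact ⟨δ, hδ, fun x s h1 h2 => ⟨hL.1 hG (hpos x s h1 h2), hR.2 hGc (hneg x s h1 h2)⟩⟩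
  -- With the sides interchanged, the same principal value would be `-2πi - πi` computed from the
  -- left and `0 + πi` from the right.
  · have t1 := hreg.tendsto_truncCauchyInt_one (s := 0) (σ := 1) (Or.inl rfl)
      (c := 2 * (Real.pi : ℂ) * I * (-1)) (by
        filter_upwards [Ioo_mem_nhdsGT hδ] with x hx
        rw [one_mul, cauchyInt_one, D.clockwise k _ (hL.2 hGc (hpos x 0 hx.1 hx.2))])
    have t2 := hreg.tendsto_truncCauchyInt_one (s := 0) (σ := -1) (Or.inr rfl)
      (c := 2 * (Real.pi : ℂ) * I * 0) (by
        filter_upwards [Ioo_mem_nhdsGT hδ] with x hx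
        rw [neg_one_mul, cauchyInt_one,
          D.windingNumber_of_mem_G k (hR.1 hG (hneg x 0 hx.1 hx.2))])
    have h3 := tendsto_nhds_unique t1 t2
    have h4 := congrArg Complex.im h3
    simp at h4
    linarith [Real.pi_pos]
  · exact (disjoint_left.1 hGGc (hR.1 hG (hneg _ 0 hδ2 hδ2')) (hR.2 hGc (hneg _ 0 hδ2 hδ2'))).elim

/-- The boundary curves, shifted slightly into the region, wind once clockwise around every point
outside the region. -/
theorem eventually_sum_windingNumber_normalShift :
    ∀ᶠ x in 𝓝[>] (0 : ℝ), (∀ j t, normalShift (D.η j) x t ∈ D.G) ∧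
      ∀ z ∉ D.G, ∑ j, windingNumber (normalShift (D.η j) x) z = -1 := by
  have hmem : ∀ᶠ x in 𝓝[>] (0 : ℝ), ∀ j t, normalShift (D.η j) x t ∈ D.G := by
    rw [eventually_all]
    intro j
    obtain ⟨δ, hδ, h⟩ := D.exists_normalShift_mem j
    filter_upwards [Ioo_mem_nhdsGT hδ] with x hx t
    exact (h x t hx.1 hx.2).1
  -- One reference point per hole suffices: the shifted curves lie in `G`, so their winding numbers
  -- are constant on each hole and extend continuously to its boundary.
  choose p hp using D.Gc_nonempty
  have hclose : ∀ᶠ x in 𝓝[>] (0 : ℝ), ∀ j k t,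
      ‖normalShift (D.η j) x t - D.η j t‖ < ‖D.η j t - p k‖ := by
    rw [eventually_all]
    intro j
    rw [eventually_all]
    intro k
    obtain ⟨M, hM, hMb⟩ := (D.periodic j).deriv_periodic.exists_norm_le
      (D.isLoop j).continuous_deriv
    obtain ⟨c, hc, hcb⟩ := Function.Periodic.exists_pos_le (f := fun t => ‖D.η j t - p k‖)
      (fun t => by simp only [D.periodic j t]) ((D.isLoop j).continuous.sub continuous_const).norm
      fun t => norm_pos_iff.2 ((D.isLoop j).sub_ne_zero_of_notMem
        (fun h => disjoint_left.1 (D.disjoint_Gc_range j k) (hp k) h) t)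
    filter_upwards [Ioo_mem_nhdsGT (show 0 < c / M by positivity)] with x hx t
    refine lt_of_lt_of_le ?_ (hcb t)
    rw [normalShift, add_sub_cancel_left, norm_mul, norm_mul, norm_I, one_mul, norm_real,
      Real.norm_of_nonneg hx.1.le]
    calc x * ‖deriv (D.η j) t‖ ≤ x * M := by
          have := hx.1.le
          gcongr
          exact hMb t
      _ < c := (lt_div_iff₀ hM).1 hx.2
  filter_upwards [hmem, hclose] with x hx1 hx2
  refine ⟨hx1, ?_⟩
  have hloop : ∀ j, IsLoop (normalShift (D.η j) x) := fun j => (D.isRegularLoop j).isLoop_normalShift x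
  have hrG : ∀ j, range (normalShift (D.η j) x) ⊆ D.G := fun j => range_subset_iff.2 (hx1 j)
  have hval : ∀ j k, ∀ z ∈ D.Gc k,
      windingNumber (normalShift (D.η j) x) z = if j = k then -1 else 0 := by
    intro j k z hz
    have h1 : Disjoint (D.Gc k) (range (normalShift (D.η j) x)) :=
      ((D.disjoint_closure_Gc k).symm.mono_right subset_closure).mono_right (hrG j)
    rw [(hloop j).windingNumber_eq_of_isPreconnected (D.isOpen_Gc k) (D.isPreconnected_Gc k) h1 hz
      (hp k), (D.isLoop j).windingNumber_eq_of_norm_sub_lt (hloop j) (hx2 j k)]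
    split_ifs with hjk
    · rw [hjk, D.clockwise k _ (hp k)]
    · exact D.windingNumber_of_mem_Gc hjk (hp k)
  have hsum : ∀ k, ∀ z ∈ closure (D.Gc k), z ∉ D.G →
      ∑ j, windingNumber (normalShift (D.η j) x) z = -1 := by
    intro k z hz hzG
    have h1 : ∀ j, windingNumber (normalShift (D.η j) x) z = if j = k then -1 else 0 := fun j =>
      (hloop j).windingNumber_eq_of_mem_closure (hval j k) hz fun h => hzG (hrG j h)
    simp [h1]
  intro z hz
  rcases D.mem_G_or_mem_Gc_or_mem_range z with h | ⟨k, h⟩ | ⟨k, s, rfl⟩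
  · exact (hz h).elim
  · exact hsum k z (subset_closure h) hz
  · exact hsum k _ (D.mem_closure_Gc k s) hz

/-- **Cauchy's theorem** for a function analytic in the region and continuous up to the boundary. -/
theorem sum_cauchyInt_eq_zero {f : ℂ → ℂ} (hf : DifferentiableOn ℂ f D.G)
    (hinf : Tendsto f (Bornology.cobounded ℂ) (𝓝 0)) (hfc : ContinuousOn f (closure D.G)) {z : ℂ}
    (hz : z ∉ closure D.G) : ∑ j, cauchyInt (D.η j) (fun t => f (D.η j t)) z = 0 := by
  have hev := D.eventually_sum_windingNumber_normalShift
  have h0 : ∀ᶠ x in 𝓝[>] (0 : ℝ),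
      ∑ j, cauchyInt (normalShift (D.η j) x) (fun t => f (normalShift (D.η j) x t)) z = 0 := by
    filter_upwards [hev] with x hx
    exact _root_.sum_cauchyInt_eq_zero D.isOpen_G hf hinf
      (fun j => (D.isRegularLoop j).isLoop_normalShift x) hx.1 hx.2 fun h => hz (subset_closure h)
  obtain ⟨δ, hδ, hδs⟩ := mem_nhdsGT_iff_exists_Ioc_subset.1 (hev.mono fun _ h => h.1)
  have hmem : ∀ x ∈ Icc 0 δ, ∀ j t, normalShift (D.η j) x t ∈ closure D.G := by
    intro x hx j t
    rcases hx.1.eq_or_lt with rfl | h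
    · rw [normalShift_zero]; exact D.mem_closure_G j t
    · exact subset_closure (hδs ⟨h, hx.2⟩ j t)
  have hlim : ∀ j, Tendsto (fun x => cauchyInt (normalShift (D.η j) x)
      (fun t => f (normalShift (D.η j) x t)) z) (𝓝[>] (0 : ℝ))
      (𝓝 (cauchyInt (D.η j) (fun t => f (D.η j t)) z)) := by
    intro j
    have hreg := D.isRegularLoop j
    -- As `z` lies off the closure of `G`, the integrand is jointly continuous up to `x = 0`, where
    -- the original curve is recovered.
    have hcont : ContinuousOn (fun x : ℝ => ∫ t in (0 : ℝ)..2 * Real.pi,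
        f (normalShift (D.η j) x t) * ((deriv (D.η j) t + x * (I * deriv (deriv (D.η j)) t)) /
          (normalShift (D.η j) x t - z))) (Icc 0 δ) := by
      refine continuousOn_parametric_intervalIntegral (ContinuousOn.mul ?_ (ContinuousOn.div ?_ ?_ ?_))
      · exact hfc.comp (f := fun p : ℝ × ℝ => normalShift (D.η j) p.1 p.2)
          hreg.continuous_normalShift.continuousOn fun p hp => hmem p.1 hp.1 j p.2
      · have h1 := hreg.isLoop.continuous_deriv
        have h2 := hreg.continuous_deriv_deriv
        exact Continuous.continuousOn (by fun_prop)
      · exact (hreg.continuous_normalShift.sub continuous_const).continuousOn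
      · rintro ⟨x, t⟩ ⟨hx, -⟩ h
        exact hz (sub_eq_zero.1 h ▸ hmem x hx j t)
    have h1 := (hcont 0 (left_mem_Icc.2 hδ.le)).tendsto.mono_left
      (nhdsWithin_le_of_mem (mem_of_superset (Ioc_mem_nhdsGT hδ) Ioc_subset_Icc_self))
    simp only [normalShift_zero, ofReal_zero, zero_mul, add_zero] at h1
    refine h1.congr fun x => ?_
    simp only [cauchyInt, hreg.deriv_normalShift]
  exact tendsto_nhds_unique (tendsto_finsetSum _ fun j _ => hlim j)
    (tendsto_const_nhds.congr' (h0.mono fun _ h => h.symm))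

/-- The boundary values of `f` in terms of the principal value of their Cauchy integral. -/
theorem tendsto_truncCauchyInt {f : ℂ → ℂ} (hf : DifferentiableOn ℂ f D.G)
    (hinf : Tendsto f (Bornology.cobounded ℂ) (𝓝 0)) (hfc : ContinuousOn f (closure D.G))
    (k : Fin m) (s : ℝ) :
    Tendsto (fun ε => truncCauchyInt (D.η k) (fun t => f (D.η k t)) s ε
        + ∑ j ∈ Finset.univ.erase k, cauchyInt (D.η j) (fun t => f (D.η j t)) (D.η k s))
      (𝓝[>] (0 : ℝ)) (𝓝 (Real.pi * I * f (D.η k s))) := by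
  have hreg := D.isRegularLoop k
  set w := D.η k s with hw
  have hfη : ∀ j, Continuous fun t => f (D.η j t) := fun j =>
    hfc.comp_continuous (D.isLoop j).continuous (D.mem_closure_G j)
  obtain ⟨δ, hδ, hside⟩ := D.exists_normalShift_mem k
  set S := ∑ j ∈ Finset.univ.erase k, cauchyInt (D.η j) (fun t => f (D.η j t)) w with hS
  -- Seen from the hole the full integral is `-2πi`, and the half jump adds `πi`.
  have hone : Tendsto (truncCauchyInt (D.η k) (fun _ => 1) s) (𝓝[>] (0 : ℝ))
      (𝓝 (-(Real.pi * I))) := by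
    have := hreg.tendsto_truncCauchyInt_one (s := s) (σ := -1) (Or.inr rfl)
      (c := 2 * (Real.pi : ℂ) * I * (-1)) (by
        filter_upwards [Ioo_mem_nhdsGT hδ] with x hx
        rw [neg_one_mul, cauchyInt_one, D.clockwise k _ (hside x s hx.1 hx.2).2])
    convert this using 2
    push_cast
    ring
  -- Subtracting the value at the base point gives a density to which the comparison of shifted and
  -- truncated integrals applies.
  set g : ℝ → ℂ := fun t => f (D.η k t) - f w with hg
  have hgc : Continuous g := (hfη k).sub continuous_const
  have hgp : Function.Periodic g (2 * Real.pi) := fun t => by simp only [hg, D.periodic k t]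
  have hdiff := hreg.tendsto_cauchyInt_sub_truncCauchyInt hgc hgp (s := s) (by simp [hg, hw])
  have hshift : Tendsto (fun x => normalShift (D.η k) (-x) s) (𝓝[>] (0 : ℝ)) (𝓝 w) := by
    have h1 : Tendsto (fun x : ℝ => -x) (𝓝[>] 0) (𝓝 0) := by
      simpa using (continuous_neg.tendsto (0 : ℝ)).mono_left nhdsWithin_le_nhds
    exact (tendsto_normalShift_zero _ _).comp h1
  -- Inside the hole Cauchy's theorem trades the `k`-th integral for minus the others, which are
  -- continuous at `w`; the subtracted constant contributes `2πi f(w)`.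
  have hcauchy : Tendsto (fun x => cauchyInt (D.η k) g (normalShift (D.η k) (-x) s))
      (𝓝[>] (0 : ℝ)) (𝓝 (-S + 2 * Real.pi * I * f w)) := by
    have h1 : Tendsto (fun x => -(∑ j ∈ Finset.univ.erase k,
        cauchyInt (D.η j) (fun t => f (D.η j t)) (normalShift (D.η k) (-x) s))
        + 2 * Real.pi * I * f w) (𝓝[>] (0 : ℝ)) (𝓝 (-S + 2 * Real.pi * I * f w)) := by
      refine (tendsto_finsetSum _ fun j hj => ?_).neg.add_const _
      have hjk : j ≠ k := (Finset.mem_erase.1 hj).1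
      have hwj : w ∉ range (D.η j) := fun h =>
        disjoint_left.1 (D.disjoint_curves hjk) h (mem_range_self s)
      exact ((((D.isLoop j).differentiableOn_cauchyInt (hfη j)).continuousOn.continuousAt
        ((D.isLoop j).isOpen_compl_range.mem_nhds hwj)).tendsto).comp hshift
    refine h1.congr' ?_
    filter_upwards [Ioo_mem_nhdsGT hδ] with x hx
    set z := normalShift (D.η k) (-x) s with hz
    have hzGc : z ∈ D.Gc k := (hside x s hx.1 hx.2).2
    have hzG : z ∉ closure D.G := fun h => disjoint_left.1 (D.disjoint_closure_Gc k) h hzGc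
    have h2 := D.sum_cauchyInt_eq_zero hf hinf hfc hzG
    rw [← Finset.add_sum_erase _ _ (Finset.mem_univ k)] at h2
    have hne := (D.isLoop k).sub_ne_zero_of_notMem
      (fun h => disjoint_left.1 (D.disjoint_Gc_range k k) hzGc h)
    have hq : Continuous fun t => deriv (D.η k) t / (D.η k t - z) :=
      (D.isLoop k).continuous_deriv.div ((D.isLoop k).continuous.sub continuous_const) hne
    have h3 : cauchyInt (D.η k) g z = cauchyInt (D.η k) (fun t => f (D.η k t)) z
        - f w * cauchyInt (D.η k) (fun _ => 1) z := by
      unfold cauchyInt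
      rw [← intervalIntegral.integral_const_mul, ← intervalIntegral.integral_sub]
      · refine intervalIntegral.integral_congr fun t _ => ?_
        simp only [hg]
        ring
      · exact ((hfη k).mul hq).intervalIntegrable _ _
      · exact (continuous_const.mul (continuous_const.mul hq)).intervalIntegrable _ _
    rw [h3, cauchyInt_one, D.clockwise k z hzGc]
    linear_combination -h2
  have htrunc := (hcauchy.sub hdiff).add (hone.const_mul (f w)) |>.add_const S
  have hval : -S + 2 * Real.pi * I * f w - 0 + f w * -(Real.pi * I) + S = Real.pi * I * f w := by ring
  rw [hval] at htrunc
  refine htrunc.congr' ?_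
  filter_upwards [Ioo_mem_nhdsGT Real.pi_pos] with x hx
  have hI : ∀ {h : ℝ → ℂ}, Continuous h → IntervalIntegrable
      (fun t => h t * (deriv (D.η k) t / (D.η k t - D.η k s))) MeasureTheory.volume
      (s + x) (s + 2 * Real.pi - x) := fun hh => by
    refine ContinuousOn.intervalIntegrable ?_
    rw [uIcc_of_le (by linarith [hx.2])]
    exact hreg.continuousOn_kernel_punctured hh hx.1
  have h4 : truncCauchyInt (D.η k) (fun t => f (D.η k t)) s x
      = truncCauchyInt (D.η k) g s x + f w * truncCauchyInt (D.η k) (fun _ => 1) s x := by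
    unfold truncCauchyInt
    rw [← intervalIntegral.integral_const_mul,
      ← intervalIntegral.integral_add (hI hgc) ((hI continuous_const).const_mul _)]
    refine intervalIntegral.integral_congr fun t _ => ?_
    simp only [hg]
    ring
  rw [h4]
  ring

end UnboundedRegion

/-! ### Difference quotients -/

/-- The mean `∫₀¹ g(s + u (t - s)) du` of `g` over the interval between `s` and `t`. -/
def segmentMean (g : ℝ → ℂ) (s t : ℝ) : ℂ := ∫ u in (0 : ℝ)..1, g (s + u * (t - s))

/-- The weighted mean `∫₀¹ u g(s + u (t - s)) du`. -/
def weightedSegmentMean (g : ℝ → ℂ) (s t : ℝ) : ℂ :=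
  ∫ u in (0 : ℝ)..1, (u : ℂ) * g (s + u * (t - s))

theorem continuous_segmentMean {g : ℝ → ℂ} (hg : Continuous g) :
    Continuous fun p : ℝ × ℝ => segmentMean g p.1 p.2 :=
  intervalIntegral.continuous_parametric_intervalIntegral_of_continuous'
    (f := fun (p : ℝ × ℝ) u => g (p.1 + u * (p.2 - p.1))) (by fun_prop) 0 1

theorem continuous_weightedSegmentMean {g : ℝ → ℂ} (hg : Continuous g) :
    Continuous fun p : ℝ × ℝ => weightedSegmentMean g p.1 p.2 :=
  intervalIntegral.continuous_parametric_intervalIntegral_of_continuous'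
    (f := fun (p : ℝ × ℝ) u => (u : ℂ) * g (p.1 + u * (p.2 - p.1))) (by fun_prop) 0 1

theorem segmentMean_self (g : ℝ → ℂ) (s : ℝ) : segmentMean g s s = g s := by simp [segmentMean]

theorem weightedSegmentMean_self (g : ℝ → ℂ) (s : ℝ) :
    weightedSegmentMean g s s = 1 / 2 * g s := by
  have h := intervalIntegral.integral_ofReal (a := 0) (b := 1) (f := fun u : ℝ => u)
    (μ := MeasureTheory.volume)
  simp only [weightedSegmentMean, sub_self, mul_zero, add_zero,
    intervalIntegral.integral_mul_const]
  simp only [integral_id] at h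
  rw [h]
  norm_num

theorem hasDerivAt_comp_segment {g : ℝ → ℂ} (hg : ContDiff ℝ 1 g) (s t u : ℝ) :
    HasDerivAt (fun u : ℝ => g (s + u * (t - s))) ((t - s) * deriv g (s + u * (t - s))) u := by
  have h1 : HasDerivAt (fun u : ℝ => s + u * (t - s)) (t - s) u := by
    simpa using ((hasDerivAt_id u).mul_const (t - s)).const_add s
  have h2 := (hg.differentiable one_ne_zero (s + u * (t - s))).hasDerivAt.scomp u h1
  refine h2.congr_deriv ?_
  rw [real_smul]
  push_cast
  ring

theorem sub_eq_mul_segmentMean {g : ℝ → ℂ} (hg : ContDiff ℝ 1 g) (s t : ℝ) :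
    g t - g s = (t - s) * segmentMean (deriv g) s t := by
  have hc := hg.continuous_deriv le_rfl
  rw [segmentMean, ← intervalIntegral.integral_const_mul,
    intervalIntegral.integral_eq_sub_of_hasDerivAt (fun u _ => hasDerivAt_comp_segment hg s t u)
      (Continuous.intervalIntegrable (by fun_prop) _ _)]
  simp

/-- Integrate the derivative of `u g(s + u (t - s))` over `[0, 1]`. -/
theorem sub_segmentMean_eq {g : ℝ → ℂ} (hg : ContDiff ℝ 1 g) (s t : ℝ) :
    g t - segmentMean g s t = (t - s) * weightedSegmentMean (deriv g) s t := by
  have hc := hg.continuous_deriv le_rfl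
  have hc' := hg.continuous
  have h1 : ∀ u ∈ uIcc (0 : ℝ) 1, HasDerivAt (fun u : ℝ => (u : ℂ) * g (s + u * (t - s)))
      (g (s + u * (t - s)) + (t - s) * (u * deriv g (s + u * (t - s)))) u := by
    intro u _
    have h2 := (hasDerivAt_id u).ofReal_comp.mul (hasDerivAt_comp_segment hg s t u)
    refine h2.congr_deriv ?_
    simp only [id, ofReal_one, one_mul]
    ring
  have h3 := intervalIntegral.integral_eq_sub_of_hasDerivAt h1
    (Continuous.intervalIntegrable (by fun_prop) _ _)
  rw [intervalIntegral.integral_add (Continuous.intervalIntegrable (by fun_prop) _ _)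
    (Continuous.intervalIntegrable (by fun_prop) _ _), intervalIntegral.integral_const_mul] at h3
  simp only [ofReal_one, one_mul, ofReal_zero, zero_mul, sub_zero, add_sub_cancel] at h3
  rw [segmentMean, weightedSegmentMean, ← h3]
  ring

namespace UnboundedRegion

variable {m : ℕ} (D : UnboundedRegion m) {A : Fin m → ℝ → ℂ}

/-! ### Continuity of the generalized Neumann kernel -/

theorem kernelN_add_zsmul (hA : IsCoefficient A) (k : Fin m) (s : ℝ) (j : Fin m) (n : ℤ) (t : ℝ) :
    D.kernelN A k s j (t + n • (2 * Real.pi)) = D.kernelN A k s j t := by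
  have h1 := (D.periodic j).zsmul n t
  have h2 := (D.periodic j).deriv_periodic.zsmul n t
  have h3 := (D.periodic j).deriv_periodic.deriv_periodic.zsmul n t
  have h4 := (hA.periodic j).zsmul n t
  have h5 := (hA.periodic j).deriv_periodic.zsmul n t
  simp only [kernelN, kernel, h1, h2, h3, h4, h5]

/-- Substituting `A(s) = A(t) - (t - s) a` and `η'(t) = q + (t - s) r` splits the kernel into the
real singular term `1 / (π (t - s))` and a remainder without singularity. On the diagonal the
weighted mean supplies the factor `1 / 2`. -/
theorem kernelN_eq_of_abs_sub_lt (hA : IsCoefficient A) (k : Fin m) {s t : ℝ}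
    (h : |t - s| < 2 * Real.pi) :
    segmentMean (deriv (D.η k)) s t ≠ 0 ∧ D.kernelN A k s k t
      = Real.pi⁻¹ * (weightedSegmentMean (deriv (deriv (D.η k))) s t
          / segmentMean (deriv (D.η k)) s t
        - segmentMean (deriv (A k)) s t * deriv (D.η k) t
          / (segmentMean (deriv (D.η k)) s t * A k t)).im := by
  have hreg := D.isRegularLoop k
  have hη := sub_eq_mul_segmentMean hreg.isLoop.contDiff s t
  have hη' := sub_segmentMean_eq hreg.contDiff_deriv s t
  have hAd := sub_eq_mul_segmentMean (hA.contDiff k) s t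
  have hA0 := hA.ne_zero k t
  rcases eq_or_ne t s with rfl | hts
  · have hd := D.deriv_ne_zero k t
    rw [segmentMean_self, segmentMean_self, weightedSegmentMean_self, kernelN, if_pos rfl]
    refine ⟨hd, ?_⟩
    congr 2
    field_simp
  · have hne := hreg.sub_ne_zero hts h
    have hts' : ((t : ℂ) - s) ≠ 0 := by
      rw [← ofReal_sub, ofReal_ne_zero]
      exact _root_.sub_ne_zero.2 hts
    have hq : segmentMean (deriv (D.η k)) s t ≠ 0 := fun h0 => hne (by rw [hη, h0, mul_zero])
    refine ⟨hq, ?_⟩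
    rw [kernelN, if_neg (_root_.sub_ne_zero.1 hne), kernel, hη]
    set q := segmentMean (deriv (D.η k)) s t
    set r := weightedSegmentMean (deriv (deriv (D.η k))) s t
    set a := segmentMean (deriv (A k)) s t
    have h1 : (Real.pi : ℂ)⁻¹ * (A k s / A k t) * (deriv (D.η k) t / ((t - s) * q))
        = ((Real.pi⁻¹ : ℝ) : ℂ) * (((t - s)⁻¹ : ℝ) + (r / q - a * deriv (D.η k) t / (q * A k t))) := by
      push_cast
      rw [mul_assoc]
      congr 1
      have e1 : A k s = A k t - (t - s) * a := by rw [← hAd]; ring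
      have e2 : r = (deriv (D.η k) t - q) / (t - s) := by
        rw [eq_div_iff hts', hη']; ring
      rw [e1, e2]
      field_simp
      ring
    rw [h1, im_ofReal_mul, add_im, ofReal_im, zero_add]

theorem continuous_kernelN (hA : IsCoefficient A) (k j : Fin m) :
    Continuous fun p : ℝ × ℝ => D.kernelN A k p.1 j p.2 := by
  have hAj := (hA.contDiff j).continuous
  have hAk := (hA.contDiff k).continuous
  have hηj := (D.isLoop j).continuous
  have hηk := (D.isLoop k).continuous
  have hηj' := (D.isLoop j).continuous_deriv
  rcases eq_or_ne j k with rfl | hjk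
  · have hlt : ∀ p : ℝ × ℝ, |p.2 - p.1| < 2 * Real.pi →
        ContinuousAt (fun p : ℝ × ℝ => D.kernelN A j p.1 j p.2) p := by
      intro p hp
      have hopen : ∀ᶠ p' : ℝ × ℝ in 𝓝 p, |p'.2 - p'.1| < 2 * Real.pi :=
        (continuous_snd.sub continuous_fst).abs.continuousAt.eventually (Iio_mem_nhds hp)
      have hq := (continuous_segmentMean hηj').continuousAt (x := p)
      have hr := (continuous_weightedSegmentMean
        (D.isRegularLoop j).continuous_deriv_deriv).continuousAt (x := p)
      have ha := (continuous_segmentMean ((hA.contDiff j).continuous_deriv le_rfl)).continuousAt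
        (x := p)
      have hq0 := (D.kernelN_eq_of_abs_sub_lt hA j hp).1
      have h1 := continuousAt_const (y := Real.pi⁻¹) |>.mul (continuous_im.continuousAt.comp
        ((hr.div hq hq0).sub ((ha.mul (hηj'.comp continuous_snd).continuousAt).div
          (hq.mul (hAj.comp continuous_snd).continuousAt) (mul_ne_zero hq0 (hA.ne_zero j p.2)))))
      refine h1.congr ?_
      filter_upwards [hopen] with p' hp'
      exact (D.kernelN_eq_of_abs_sub_lt hA j hp').2.symm
    rw [continuous_iff_continuousAt]
    intro p
    -- Translating `t` by a multiple of `2π` to within `π` of `s` reduces every point to the range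
    -- where the formula holds.
    set n := toIcoDiv Real.two_pi_pos (p.1 - Real.pi) p.2
    have hmod := toIcoMod_mem_Ico Real.two_pi_pos (p.1 - Real.pi) p.2
    rw [toIcoMod] at hmod
    have h1 := hlt (p.1, p.2 - n • (2 * Real.pi)) (by
      rw [abs_lt]
      constructor <;> linarith [hmod.1, hmod.2, Real.pi_pos])
    have h2 : ContinuousAt (fun p' : ℝ × ℝ => (p'.1, p'.2 - n • (2 * Real.pi))) p := by fun_prop
    refine (ContinuousAt.comp (g := fun p : ℝ × ℝ => D.kernelN A j p.1 j p.2)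
      (f := fun p : ℝ × ℝ => (p.1, p.2 - n • (2 * Real.pi))) h1 h2).congr ?_
    refine Eventually.of_forall fun p' => ?_
    have := D.kernelN_add_zsmul hA j p'.1 j n (p'.2 - n • (2 * Real.pi))
    rw [sub_add_cancel] at this
    exact this.symm
  · have hne : ∀ p : ℝ × ℝ, D.η j p.2 ≠ D.η k p.1 := fun p h =>
      disjoint_left.1 (D.disjoint_curves hjk) ⟨p.2, h⟩ (mem_range_self p.1)
    simp only [kernelN, hne, if_false, kernel]
    have h1 : Continuous fun p : ℝ × ℝ => A k p.1 / A j p.2 :=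
      (hAk.comp continuous_fst).div (hAj.comp continuous_snd) fun p => hA.ne_zero j p.2
    have h2 : Continuous fun p : ℝ × ℝ => deriv (D.η j) p.2 / (D.η j p.2 - D.η k p.1) :=
      (hηj'.comp continuous_snd).div ((hηj.comp continuous_snd).sub (hηk.comp continuous_fst))
        fun p => _root_.sub_ne_zero.2 (hne p)
    exact continuous_im.comp ((continuous_const.mul h1).mul h2)

/-! ### The integral equation -/

/-- The real part of `(M + iN)(γ + iμ)` is `M γ - N μ`, while `γ + iμ = A f` cancels the `A(t)` in
the denominator. -/
theorem integral_kernelM_eq (hA : IsCoefficient A) {γ μ : Fin m → ℝ → ℝ} {f : ℂ → ℂ}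
    (hfc : ContinuousOn f (closure D.G))
    (hμ : ∀ k s, A k s * f (D.η k s) = (γ k s : ℂ) + Complex.I * (μ k s : ℂ))
    (hμc : ∀ k, Continuous (μ k)) (k : Fin m) (s : ℝ) (j : Fin m) {a b : ℝ}
    (hne : ∀ t ∈ uIcc a b, D.η j t - D.η k s ≠ 0) :
    ∫ t in a..b, D.kernelM A k s j t * γ j t
      = (((Real.pi : ℂ)⁻¹ * A k s) *
          ∫ t in a..b, f (D.η j t) * (deriv (D.η j) t / (D.η j t - D.η k s))).re
        + ∫ t in a..b, D.kernelN A k s j t * μ j t := by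
  have hfη : Continuous fun t => f (D.η j t) :=
    hfc.comp_continuous (D.isLoop j).continuous (D.mem_closure_G j)
  have hint : IntervalIntegrable (fun t => (Real.pi : ℂ)⁻¹ * A k s *
      (f (D.η j t) * (deriv (D.η j) t / (D.η j t - D.η k s)))) MeasureTheory.volume a b := by
    refine ContinuousOn.intervalIntegrable ?_
    exact continuousOn_const.mul (hfη.continuousOn.mul
      ((D.isLoop j).continuous_deriv.continuousOn.div
      ((D.isLoop j).continuous.sub continuous_const).continuousOn hne))
  have hN : Continuous fun t => D.kernelN A k s j t * μ j t :=
    ((D.continuous_kernelN hA k j).comp (continuous_const.prodMk continuous_id)).mul (hμc j)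
  have hre : (∫ t in a..b, ((Real.pi : ℂ)⁻¹ * A k s *
      (f (D.η j t) * (deriv (D.η j) t / (D.η j t - D.η k s)))).re)
      = (∫ t in a..b, (Real.pi : ℂ)⁻¹ * A k s *
      (f (D.η j t) * (deriv (D.η j) t / (D.η j t - D.η k s)))).re :=
    reCLM.intervalIntegral_comp_comm hint
  have hint_re : IntervalIntegrable (fun t => ((Real.pi : ℂ)⁻¹ * A k s *
      (f (D.η j t) * (deriv (D.η j) t / (D.η j t - D.η k s)))).re) MeasureTheory.volume a b :=
    ⟨hint.1.re, hint.2.re⟩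
  rw [← intervalIntegral.integral_const_mul, ← hre,
    ← intervalIntegral.integral_add hint_re (hN.intervalIntegrable _ _)]
  refine intervalIntegral.integral_congr fun t ht => ?_
  have h1 : (Real.pi : ℂ)⁻¹ * A k s * (f (D.η j t) * (deriv (D.η j) t / (D.η j t - D.η k s)))
      = D.kernel A k s j t * ((γ j t : ℂ) + Complex.I * (μ j t : ℂ)) := by
    rw [← hμ, kernel]
    have := hA.ne_zero j t
    field_simp
  rw [h1, kernelN, if_neg (_root_.sub_ne_zero.1 (hne t ht)), kernelM]
  simp

/-- Only the Cauchy part of the identity for `M γ` is singular, and its limit is the boundary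
formula; the `N μ` part has a continuous integrand, so its truncation simply disappears. -/
theorem tendsto_truncM (hA : IsCoefficient A) {γ μ : Fin m → ℝ → ℝ} {f : ℂ → ℂ}
    (hf : D.IsRHSolution A γ f)
    (hμ : ∀ k s, A k s * f (D.η k s) = (γ k s : ℂ) + Complex.I * (μ k s : ℂ))
    (k : Fin m) (s : ℝ) :
    Tendsto (D.truncM A γ k s) (𝓝[>] (0 : ℝ)) (𝓝 (-μ k s + D.opN A μ k s)) := by
  have hμim : ∀ k, μ k = fun s => (A k s * f (D.η k s)).im := fun k => by
    funext s; simp [hμ]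
  have hμc : ∀ k, Continuous (μ k) := fun k => by
    rw [hμim]
    exact continuous_im.comp ((hA.contDiff k).continuous.mul
      (hf.continuousOn.comp_continuous (D.isLoop k).continuous (D.mem_closure_G k)))
  have hμp : Function.Periodic (μ k) (2 * Real.pi) := fun t => by
    simp only [hμim, hA.periodic k t, D.periodic k t]
  have hN : Continuous fun t => D.kernelN A k s k t * μ k t :=
    ((D.continuous_kernelN hA k k).comp (continuous_const.prodMk continuous_id)).mul (hμc k)
  have hNp : Function.Periodic (fun t => D.kernelN A k s k t * μ k t) (2 * Real.pi) := fun t => by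
    have := D.kernelN_add_zsmul hA k s k 1 t
    rw [one_zsmul] at this
    simp only [this, hμp t]
  have hNlim : Tendsto (fun ε => ∫ t in (s + ε)..(s + 2 * Real.pi - ε),
      D.kernelN A k s k t * μ k t) (𝓝[>] (0 : ℝ))
      (𝓝 (∫ t in (0 : ℝ)..2 * Real.pi, D.kernelN A k s k t * μ k t)) := by
    have hcont : Continuous fun ε : ℝ => ∫ t in (s + ε)..(s + 2 * Real.pi - ε),
        D.kernelN A k s k t * μ k t := by
      have hprim : Continuous fun b : ℝ => ∫ t in (0 : ℝ)..b, D.kernelN A k s k t * μ k t :=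
        intervalIntegral.continuous_primitive (fun _ _ => hN.intervalIntegrable _ _) 0
      have h1 : ∀ ε : ℝ, ∫ t in (s + ε)..(s + 2 * Real.pi - ε), D.kernelN A k s k t * μ k t
          = (∫ t in (0 : ℝ)..(s + 2 * Real.pi - ε), D.kernelN A k s k t * μ k t)
            - ∫ t in (0 : ℝ)..(s + ε), D.kernelN A k s k t * μ k t := fun ε =>
        (intervalIntegral.integral_interval_sub_left (hN.intervalIntegrable _ _)
          (hN.intervalIntegrable _ _)).symm
      simp only [h1]
      exact (hprim.comp (by fun_prop)).sub (hprim.comp (by fun_prop))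
    have h2 := (hcont.tendsto 0).mono_left (nhdsWithin_le_nhds (s := Ioi 0))
    simp only [add_zero, sub_zero] at h2
    have h3 := hNp.intervalIntegral_add_eq s 0
    rw [zero_add] at h3
    rwa [h3] at h2
  have hC := D.tendsto_truncCauchyInt hf.analytic hf.infty_zero hf.continuousOn k s
  have hCre := (continuous_re.tendsto _).comp (hC.const_mul ((Real.pi : ℂ)⁻¹ * A k s))
  have hlim := hCre.add (hNlim.add_const (∑ j ∈ Finset.univ.erase k,
    ∫ t in (0 : ℝ)..2 * Real.pi, D.kernelN A k s j t * μ j t))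
  have hval : ((Real.pi : ℂ)⁻¹ * A k s * (Real.pi * I * f (D.η k s))).re = -μ k s := by
    have hpi : (Real.pi : ℂ) ≠ 0 := ofReal_ne_zero.2 Real.pi_ne_zero
    have : (Real.pi : ℂ)⁻¹ * A k s * (Real.pi * I * f (D.η k s)) = I * (A k s * f (D.η k s)) := by
      field_simp
    rw [this, hμ]
    simp
  rw [hval, Finset.add_sum_erase Finset.univ
    (fun j => ∫ t in (0 : ℝ)..2 * Real.pi, D.kernelN A k s j t * μ j t) (Finset.mem_univ k)] at hlim
  refine hlim.congr' ?_
  filter_upwards [Ioo_mem_nhdsGT Real.pi_pos] with ε hε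
  have h1 := D.integral_kernelM_eq hA hf.continuousOn hμ hμc k s k
    (a := s + ε) (b := s + 2 * Real.pi - ε) (fun t ht => by
      rw [uIcc_of_le (by linarith [hε.2])] at ht
      exact (D.isRegularLoop k).sub_ne_zero_of_mem_Icc hε.1 ht)
  have h2 : ∀ j ∈ Finset.univ.erase k, ∫ t in (0 : ℝ)..2 * Real.pi, D.kernelM A k s j t * γ j t
      = ((Real.pi : ℂ)⁻¹ * A k s * cauchyInt (D.η j) (fun t => f (D.η j t)) (D.η k s)).re
        + ∫ t in (0 : ℝ)..2 * Real.pi, D.kernelN A k s j t * μ j t := fun j hj =>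
    D.integral_kernelM_eq hA hf.continuousOn hμ hμc k s j fun t _ =>
      (D.isLoop j).sub_ne_zero_of_notMem (fun h => disjoint_left.1
        (D.disjoint_curves (Finset.mem_erase.1 hj).1) h (mem_range_self s)) t
  rw [truncM, h1, Finset.sum_congr rfl h2, Finset.sum_add_distrib]
  simp only [Function.comp_apply, mul_add, add_re, Finset.mul_sum, re_sum]
  unfold truncCauchyInt
  ring

end UnboundedRegion

/-- If `f` solves the Riemann-Hilbert problem `Re [A f⁺] = γ` and `A f⁺ = γ + i μ`, then
`μ - 𝐍 μ = -𝐌 γ`.  The first two parts of the conclusion say that the equation is meaningful: the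
kernel of `𝐍` is continuous, and the principal value that defines `𝐌 γ` exists. -/
theorem mainTheorem1 {m : ℕ} (D : UnboundedRegion m) (A : Fin m → ℝ → ℂ) (hA : IsCoefficient A)
    (γ μ : Fin m → ℝ → ℝ) (hγ : γ ∈ holderSpace m) (f : ℂ → ℂ) (hf : D.IsRHSolution A γ f)
    (hμ : ∀ k s, A k s * f (D.η k s) = (γ k s : ℂ) + Complex.I * (μ k s : ℂ)) :
    (∀ k j, Continuous fun p : ℝ × ℝ => D.kernelN A k p.1 j p.2) ∧
    (∀ k s, Tendsto (D.truncM A γ k s) (𝓝[>] (0 : ℝ)) (𝓝 (D.opM A γ k s))) ∧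
    (∀ k s, μ k s - D.opN A μ k s = -D.opM A γ k s) := by
  have hlim := D.tendsto_truncM hA hf hμ
  have hop : ∀ k s, D.opM A γ k s = -μ k s + D.opN A μ k s := fun k s => (hlim k s).limUnder_eq
  refine ⟨D.continuous_kernelN hA, fun k s => ?_, fun k s => ?_⟩
  · rw [hop]; exact hlim k s
  · rw [hop]; ring

end
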